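/- Let $\psi:[0,\infty)\to[0,\infty)$ be a nondecreasing map of $[0,\infty)$ onto $[0,\infty)$ such that $\psi(x)/x^2\to 0$ as $x\to 0^+$. Let $\mathbb D=\{-1,1\}^{\{1,2,3,\dots\}}$, with its normalized Haar measure and coordinate functions $r_1,r_2,\dots$. The Walsh functions on $\mathbb D$ are $w_n=\prod_{j\ge1} r_j^{\alpha_j}$, where $n=\sum_{j\ge1}\alpha_j2^{j-1}$ with $\alpha_j\in\{0,1\}$ ($n=0,1,2,\dots$). The Walsh functions on $[0,1]$ are defined by the same formula with $r_j(x)=(-1)^{\lfloor 2^jx\rfloor}$. In both cases put $\widehat\mu(n)=\int w_n\,d\mu$. Then: (a) There is a probability measure $\mu$ on $\mathbb D$, singular with respect to Haar measure, such that $\sum_{n=0}^{N-1}\widehat\mu(n)\,w_n(x)\ge 0$ for all $N\ge 0$ and all $x\in\mathbb D$, and $\sum_{n=0}^\infty\psi(|\widehat\mu(n)|)<\infty$. Likewise there is a probability measure $\mu$ on $[0,1]$, singular with respect to Lebesgue measure, such that $\sum_{n=0}^{N-1}\widehat\mu(n)\,w_n(x)\ge 0$ for all $N\ge 0$ and all $x\in[0,1]$,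 and $\sum_{n=0}^\infty\psi(|\widehat\mu(n)|)<\infty$. (b) There is a probability measure $\mu$ on the circle $\mathbb R/\mathbb Z$, singular with respect to Lebesgue measure, whose Fourier coefficients $\widehat\mu(n)=\int e^{-2\pi i nt}\,d\mu(t)$ satisfy $\sum_{|n|\le N}\widehat\mu(n)\,e^{2\pi i nt}\ge 0$ for all $N\ge0$ and all $t\in\mathbb R/\mathbb Z$, and $\sum_{n\in\mathbb Z}\psi(|\widehat\mu(n)|)<\infty$. -/

import Mathlib

open MeasureTheory Filter Topology
open scoped NNReal ENNReal ComplexOrder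

/-- The Cantor group `{-1, 1}^ℕ*`. The coordinate of index `j : ℕ` is the Rademacher function
usually written `r_{j+1}`. -/
abbrev CantorGroup : Type := ℕ → ℤˣ

/-- The uniform probability measure on `{-1, 1}`. -/
noncomputable def signMeasure : Measure ℤˣ :=
  (2⁻¹ : ℝ≥0∞) • (Measure.dirac 1 + Measure.dirac (-1))

instance : DiscreteMeasurableSpace ℤˣ :=
  ⟨fun s => ⟨Units.val '' s, MeasurableSet.of_discrete, Set.preimage_image_eq s Units.val_injective⟩⟩

instance : IsProbabilityMeasure signMeasure :=
  ⟨by simp [signMeasure, ENNReal.inv_two_add_inv_two]⟩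

/-- The normalized Haar measure of the Cantor group, that is, the product of the uniform
probability measures on the factors `{-1, 1}`. -/
noncomputable def cantorHaar : Measure CantorGroup :=
  Measure.infinitePi (fun _ : ℕ => signMeasure)

/-- The Walsh function `w_n` on the Cantor group: the product of the coordinates whose index is
the position of a digit `1` in the binary expansion of `n`, so that `w_0 = 1`, `w_1 = r_1`,
`w_2 = r_2`, `w_3 = r_1 r_2`, `w_4 = r_3`, etc. -/
def walsh (n : ℕ) (x : CantorGroup) : ℝ :=
  ∏ j ∈ n.bitIndices.toFinset, ((x j : ℤ) : ℝ)

/-- The `n`-th Fourier-Walsh coefficient of a measure on the Cantor group. -/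
noncomputable def walshCoeff (μ : Measure CantorGroup) (n : ℕ) : ℝ :=
  ∫ x, walsh n x ∂μ

/-- The partial sum of order `N` (the first `N` terms) of the Walsh series of a measure on the
Cantor group. -/
noncomputable def walshPartialSum (μ : Measure CantorGroup) (N : ℕ) (x : CantorGroup) : ℝ :=
  ∑ n ∈ Finset.range N, walshCoeff μ n * walsh n x

/-- The point of the Cantor group with coordinates `r_j(x) = (-1)^⌊2^j x⌋`, `j = 1, 2, …`:
the values at `x` of the (right-continuous, 1-periodic) Rademacher functions. -/
noncomputable def rademacherPoint (x : unitInterval) : CantorGroup :=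
  fun j => (-1) ^ ⌊(2 : ℝ) ^ (j + 1) * (x : ℝ)⌋₊

/-- The Walsh function `w_n` on `[0, 1]`. -/
noncomputable def walshUnit (n : ℕ) (x : unitInterval) : ℝ :=
  walsh n (rademacherPoint x)

/-- The `n`-th Fourier-Walsh coefficient of a measure on `[0, 1]`. -/
noncomputable def walshUnitCoeff (μ : Measure unitInterval) (n : ℕ) : ℝ :=
  ∫ x, walshUnit n x ∂μ

/-- The partial sum of order `N` of the Walsh series of a measure on `[0, 1]`. -/
noncomputable def walshUnitPartialSum (μ : Measure unitInterval) (N : ℕ) (x : unitInterval) : ℝ :=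
  ∑ n ∈ Finset.range N, walshUnitCoeff μ n * walshUnit n x

/-- The `n`-th Fourier coefficient `∫ e^{-2πint} dμ(t)` of a measure on the circle `ℝ / ℤ`. -/
noncomputable def measureFourierCoeff (μ : Measure UnitAddCircle) (n : ℤ) : ℂ :=
  ∫ t, fourier (-n) t ∂μ

/-- The symmetric partial sum `∑_{|n| ≤ N} μ̂(n) e^{2πint}` of the Fourier series of a measure on
the circle. -/
noncomputable def fourierPartialSum (μ : Measure UnitAddCircle) (N : ℕ) (t : UnitAddCircle) : ℂ :=
  ∑ n ∈ Finset.Icc (-(N : ℤ)) (N : ℤ), measureFourierCoeff μ n * fourier n t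

/-! The measure is a Riesz-type product: a weak limit of densities f_n = ∏_{i<n} (1 + g_i), where
the frequencies of g_i lie far above those of f_i. Each g_i must carry a fixed amount of L² mass, to
force singularity, yet add arbitrarily little to ∑ ψ(|μ̂|). Flatness reconciles the two: the mass is
spread over about 2^k coefficients of size about 2^(-k/2), and ψ(x) = o(x²) sends their ψ-sum to 0
as k grows.

Rudin-Shapiro polynomials are flat in this sense, and all their partial sums are also O(2^(k/2)), so
those of the normalized g are at most 1/2 in absolute value. Below the degree of f, the partial sums
of f(1 + g) are those of f; beyond it they equal f(1 + S_N g) ≥ f/2 up to an edge error, at most a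
constant depending on f times the size of the coefficients of g. A large k makes this error smaller
than a quarter of the positive lower bound δ for the partial sums of f, so positivity survives
(`IsGoodWalsh.exists_mul`, `IsGoodTrig.exists_mul`).

For singularity, g uses both members of a Rudin-Shapiro pair, near the frequencies 2^A and 2^(A+1).
Since |P|² + |Q|² is constant, g² is a constant c plus high frequencies. Thus the g_i are orthogonal
under Haar measure, while under μ they have mean c and are pairwise uncorrelated; Chebyshev's
inequality separates their averages (`mutuallySingular_of_means`, `exists_singular_of_step`).

Binary expansion carries the measure from the Cantor group to [0,1]. It is invertible off a
countable set, so μ must have no atoms: f ≤ (3/2)^D in degree 2^D, whereas an atom would make the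
partial sums grow like 2^D. -/

/-- The mass of μ ⊓ ν is at most μ(Aᶜ) + ν(A) for every A, hence zero. -/
theorem mutuallySingular_of_forall_measureReal_le {X : Type*} [MeasurableSpace X]
    (μ ν : Measure X) [IsFiniteMeasure μ]
    [IsFiniteMeasure ν] (h : ∀ ε > 0, ∃ A, μ.real Aᶜ ≤ ε ∧ ν.real A ≤ ε) : μ ⟂ₘ ν := by
  rw [Measure.mutuallySingular_iff_disjoint, disjoint_iff_inf_le]
  intro s
  set σ := μ ⊓ ν
  have : IsFiniteMeasure σ := ⟨(inf_le_left (a := μ) (b := ν) _).trans_lt (measure_lt_top μ _)⟩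
  have h0 : σ.real Set.univ ≤ 0 := by
    refine le_of_forall_pos_le_add fun ε hε => ?_
    obtain ⟨A, h1, h2⟩ := h (ε / 2) (by positivity)
    have h3 : σ.real Set.univ ≤ σ.real Aᶜ + σ.real A := by
      rw [← Set.compl_union_self A]; exact measureReal_union_le _ _
    have h4 : σ.real Aᶜ ≤ μ.real Aᶜ :=
      ENNReal.toReal_mono (measure_ne_top _ _) (inf_le_left (a := μ) (b := ν) _)
    have h5 : σ.real A ≤ ν.real A :=
      ENNReal.toReal_mono (measure_ne_top _ _) (inf_le_right (a := μ) (b := ν) _)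
    linarith
  have h1 : σ Set.univ = 0 := by
    have := le_antisymm h0 measureReal_nonneg
    rwa [measureReal_eq_zero_iff] at this
  exact (measure_mono (Set.subset_univ s)).trans (h1.le.trans (zero_le))

/-! ### Second moments and abstract Riesz products -/

section AbstractRiesz

variable {X : Type*} [TopologicalSpace X] [CompactSpace X] [MeasurableSpace X]
  [BorelSpace X]

theorem integrable_continuousMap {E : Type*} [NormedAddCommGroup E] (f : C(X, E))
    (ν : Measure X) [IsFiniteMeasure ν] : Integrable (fun x => f x) ν :=
  f.continuous.integrable_of_hasCompactSupport (HasCompactSupport.of_compactSpace _)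

/-- The integral against a finite measure, as a linear form on continuous functions. -/
noncomputable def meanForm (ν : Measure X) [IsFiniteMeasure ν] : C(X, ℝ) →ₗ[ℝ] ℝ where
  toFun f := ∫ x, f x ∂ν
  map_add' f g := integral_add (integrable_continuousMap f ν) (integrable_continuousMap g ν)
  map_smul' c _ := integral_const_mul c _

theorem meanForm_apply (ν : Measure X) [IsFiniteMeasure ν] (f : C(X, ℝ)) :
    meanForm ν f = ∫ x, f x ∂ν := rfl

theorem meanForm_one (ν : Measure X) [IsProbabilityMeasure ν] : meanForm ν 1 = 1 := by
  simp [meanForm_apply]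

theorem meanForm_mono (ν : Measure X) [IsFiniteMeasure ν] {f g : C(X, ℝ)}
    (h : ∀ x, f x ≤ g x) : meanForm ν f ≤ meanForm ν g :=
  integral_mono (integrable_continuousMap f ν) (integrable_continuousMap g ν) h

theorem meanForm_sum_sq_le (ν : Measure X) [IsProbabilityMeasure ν] (Y : ℕ → C(X, ℝ))
    (hY : ∀ i x, |Y i x| ≤ 1) (horth : ∀ i j, i < j → meanForm ν (Y i * Y j) = 0) (n : ℕ) :
    meanForm ν ((∑ i ∈ Finset.range n, Y i) ^ 2) ≤ n := by
  induction n with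
  | zero => simp
  | succ n ih =>
    have h1 : meanForm ν ((∑ i ∈ Finset.range n, Y i) * Y n) = 0 := by
      rw [Finset.sum_mul, map_sum]
      exact Finset.sum_eq_zero fun i hi => horth i n (Finset.mem_range.1 hi)
    have h2 : meanForm ν (Y n ^ 2) ≤ 1 := by
      rw [← meanForm_one ν]
      refine meanForm_mono ν fun x => ?_
      simpa using (sq_le_one_iff_abs_le_one _).2 (hY n x)
    have h3 : (∑ i ∈ Finset.range (n + 1), Y i) ^ 2 = (∑ i ∈ Finset.range n, Y i) ^ 2
        + (2 : ℝ) • ((∑ i ∈ Finset.range n, Y i) * Y n) + Y n ^ 2 := by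
      rw [Finset.sum_range_succ, two_smul]; ring
    rw [h3, map_add, map_add, map_smul, h1]
    push_cast; simp; linarith

/-- Chebyshev's inequality: orthogonality bounds the second moment of the sum by n. -/
theorem measureReal_sq_le_sum (ν : Measure X) [IsProbabilityMeasure ν] (Y : ℕ → C(X, ℝ))
    (hY : ∀ i x, |Y i x| ≤ 1) (horth : ∀ i j, i < j → meanForm ν (Y i * Y j) = 0)
    {δ : ℝ} (hδ : 0 < δ) {n : ℕ} (hn : 0 < n) :
    ν.real {x | (δ * n) ^ 2 ≤ (∑ i ∈ Finset.range n, Y i x) ^ 2} ≤ 1 / (δ ^ 2 * n) := by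
  have h1 := mul_meas_ge_le_integral_of_nonneg (μ := ν)
    (f := fun x => ((∑ i ∈ Finset.range n, Y i) ^ 2 : C(X, ℝ)) x)
    (Eventually.of_forall fun x => by simpa using sq_nonneg _)
    (integrable_continuousMap _ ν) ((δ * n) ^ 2)
  have h2 := meanForm_sum_sq_le ν Y hY horth n
  rw [meanForm_apply] at h2
  have hn' : (0 : ℝ) < n := by exact_mod_cast hn
  have h3 := h1.trans h2
  simp only [ContinuousMap.coe_pow, ContinuousMap.coe_sum, Pi.pow_apply, Finset.sum_apply] at h3
  rw [le_div_iff₀ (by positivity)]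
  have : (δ * n) ^ 2 = (δ ^ 2 * n) * n := by ring
  rw [this] at h3 ⊢
  nlinarith

theorem mutuallySingular_of_means (μ ν : Measure X) [IsProbabilityMeasure μ]
    [IsProbabilityMeasure ν] (g : ℕ → C(X, ℝ)) {c : ℝ} (hc : 0 < c) (hc1 : c ≤ 1 / 2)
    (hg : ∀ i x, |g i x| ≤ 1 / 2)
    (hν : ∀ i j, i < j → meanForm ν (g i * g j) = 0)
    (hμ1 : ∀ i, meanForm μ (g i) = c)
    (hμ : ∀ i j, i < j → meanForm μ (g i * g j) = c ^ 2) : μ ⟂ₘ ν := by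
  refine mutuallySingular_of_forall_measureReal_le μ ν fun ε hε => ?_
  obtain ⟨n, hn⟩ := exists_nat_gt (1 / ((c / 2) ^ 2 * ε))
  have hn0 : (0 : ℝ) < n := lt_trans (by positivity) hn
  have hn0' : 0 < n := by exact_mod_cast hn0
  have hle : 1 / ((c / 2) ^ 2 * n) ≤ ε := by
    rw [div_lt_iff₀ (by positivity)] at hn
    rw [div_le_iff₀ (by positivity)]
    nlinarith
  -- The averages of the g i concentrate at 0 under ν and at c under μ; the cut is halfway. The
  -- bound c ≤ 1/2 keeps |g i - c| ≤ 1.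
  refine ⟨{x | (c / 2 * n) ^ 2 ≤ (∑ i ∈ Finset.range n, g i x) ^ 2}, ?_, ?_⟩
  · refine le_trans ?_ hle
    refine le_trans ?_ (measureReal_sq_le_sum μ (fun i => g i - c • 1) ?_ ?_ (half_pos hc) hn0')
    · refine measureReal_mono fun x hx => ?_
      simp only [Set.mem_compl_iff, Set.mem_ofPred_eq, not_le] at hx ⊢
      have h1 : ∑ i ∈ Finset.range n, (g i - c • (1 : C(X, ℝ))) x
          = ∑ i ∈ Finset.range n, g i x - c * n := by
        simp [Finset.sum_sub_distrib, mul_comm]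
      rw [h1]
      have h2 := abs_lt_of_sq_lt_sq hx (by positivity)
      have h3 := (abs_lt.1 h2).2
      nlinarith [mul_pos hc hn0]
    · intro i x
      have := abs_le.1 (hg i x)
      simp only [ContinuousMap.sub_apply, ContinuousMap.smul_apply, ContinuousMap.one_apply,
        smul_eq_mul, mul_one]
      rw [abs_le]; constructor <;> linarith
    · intro i j hij
      have : (g i - c • (1 : C(X, ℝ))) * (g j - c • (1 : C(X, ℝ)))
          = g i * g j - c • g i - c • g j + (c ^ 2) • (1 : C(X, ℝ)) := by
        ext x; simp; ring
      rw [this]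
      simp only [map_add, map_sub, map_smul, hμ i j hij, hμ1, meanForm_one, smul_eq_mul]
      ring
  · refine le_trans ?_ hle
    exact measureReal_sq_le_sum ν g (fun i x => (hg i x).trans (by norm_num)) hν (half_pos hc) hn0'

variable [T2Space X]

/-- A cluster point of a sequence of probability densities against which the integral of every
function in a given class is eventually constant. -/
theorem exists_probability_of_eventually_const (ν : Measure X) [IsProbabilityMeasure ν]
    (f : ℕ → C(X, ℝ)) (hf : ∀ k x, 0 ≤ f k x) (hf1 : ∀ k, meanForm ν (f k) = 1) :
    ∃ μ : Measure X, ∃ _ : IsProbabilityMeasure μ, ∀ (u : C(X, ℝ)) (a : ℝ) (k₀ : ℕ),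
      (∀ k ≥ k₀, meanForm ν (u * f k) = a) → meanForm μ u = a := by
  let m : ℕ → Measure X := fun k => ν.withDensity fun x => ENNReal.ofReal (f k x)
  have hm : ∀ k, IsProbabilityMeasure (m k) := fun k => ⟨by
    rw [withDensity_apply _ MeasurableSet.univ, Measure.restrict_univ,
      ← ofReal_integral_eq_lintegral_ofReal (integrable_continuousMap _ ν)
        (Eventually.of_forall (hf k)), ← meanForm_apply, hf1, ENNReal.ofReal_one]⟩
  let M : ℕ → ProbabilityMeasure X := fun k => ⟨m k, hm k⟩
  -- Without metrizability there may be no convergent subsequence; an ultrafilter replaces it, and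
  -- the limit of an eventually constant sequence along it is that constant.
  obtain ⟨μ, hμ⟩ := exists_clusterPt_of_compactSpace (map M atTop)
  obtain ⟨U, hU, hUle⟩ := mapClusterPt_iff_ultrafilter.1 (show MapClusterPt μ atTop M from hμ)
  refine ⟨μ, inferInstance, fun u a k₀ hk => ?_⟩
  have h1 := ProbabilityMeasure.tendsto_iff_forall_integral_tendsto.1 hUle
    (BoundedContinuousFunction.mkOfCompact u)
  have h2 : ∀ᶠ k in (U : Filter ℕ), ∫ x, BoundedContinuousFunction.mkOfCompact u x ∂(M k : Measure X) = a := by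
    filter_upwards [hU (eventually_ge_atTop k₀)] with k hk'
    rw [← hk k hk', meanForm_apply]
    have : (M k : Measure X) = ν.withDensity fun x => ENNReal.ofReal (f k x) := rfl
    rw [this, integral_withDensity_eq_integral_toReal_smul
      (f k).continuous.measurable.ennreal_ofReal (Eventually.of_forall fun _ => ENNReal.ofReal_lt_top)]
    refine integral_congr_ae (Eventually.of_forall fun x => ?_)
    simp [ENNReal.toReal_ofReal (hf k x), mul_comm]
  have h3 := tendsto_nhds_unique h1 ((tendsto_congr' h2).2 tendsto_const_nhds)
  simpa [meanForm_apply] using h3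

/-- A singular probability measure obtained by iterating multiplications by factors `1 + g`, where
each `g` is uncorrelated with the low-degree functions constructed before it. -/
theorem exists_singular_of_step (ν : Measure X) [IsProbabilityMeasure ν]
    (P : ℕ → Set C(X, ℝ)) (hmono : Monotone P) (hone : 1 ∈ P 0)
    (hmul : ∀ m n u v, u ∈ P m → v ∈ P n → u * v ∈ P (m + n)) {c : ℝ} (hc : 0 < c)
    (hc1 : c ≤ 1 / 2)
    (Good : ℕ → C(X, ℝ) → Prop) (hGP : ∀ D f, Good D f → f ∈ P D)
    (h1 : Good 0 1)
    (step : ∀ D f, Good D f → ∃ D' > D, ∃ g ∈ P D', (∀ x, |g x| ≤ 1 / 2) ∧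
      (∀ u ∈ P (3 * D), meanForm ν (u * g) = 0 ∧ meanForm ν (u * g ^ 2) = c * meanForm ν u) ∧
      Good D' (f * (1 + g))) :
    ∃ μ : Measure X, ∃ _ : IsProbabilityMeasure μ, μ ⟂ₘ ν ∧
      ∀ K, ∃ D ≥ K, ∃ f, Good D f ∧ ∀ u ∈ P D, meanForm μ u = meanForm ν (u * f) := by
  choose! D' hD' g hgP hg hgu hgG using step
  let s : ℕ → {p : ℕ × C(X, ℝ) // Good p.1 p.2} := fun n => Nat.rec ⟨(0, 1), h1⟩
    (fun _ p => ⟨(D' p.1.1 p.1.2, p.1.2 * (1 + g p.1.1 p.1.2)), hgG _ _ p.2⟩) n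
  let d : ℕ → ℕ := fun n => (s n).1.1
  let f : ℕ → C(X, ℝ) := fun n => (s n).1.2
  let G : ℕ → C(X, ℝ) := fun n => g (d n) (f n)
  have hgood : ∀ n, Good (d n) (f n) := fun n => (s n).2
  have hf0 : f 0 = 1 := rfl
  have hfs : ∀ n, f (n + 1) = f n * (1 + G n) := fun n => rfl
  have hds : ∀ n, d n < d (n + 1) := fun n => hD' _ _ (hgood n)
  have hd : StrictMono d := strictMono_nat_of_lt_succ hds
  have hfP : ∀ n, f n ∈ P (d n) := fun n => hGP _ _ (hgood n)
  have hGPn : ∀ n, G n ∈ P (d (n + 1)) := fun n => hgP _ _ (hgood n)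
  have hGb : ∀ n x, |G n x| ≤ 1 / 2 := fun n => hg _ _ (hgood n)
  have hG1 : ∀ n, ∀ u ∈ P (3 * d n), meanForm ν (u * G n) = 0 := fun n u hu =>
    (hgu _ _ (hgood n) u hu).1
  have hG2 : ∀ n, ∀ u ∈ P (3 * d n), meanForm ν (u * G n ^ 2) = c * meanForm ν u :=
    fun n u hu => (hgu _ _ (hgood n) u hu).2
  clear_value f d G
  have hfpos : ∀ n x, 0 ≤ f n x := by
    intro n x
    induction n with
    | zero => simp [hf0]
    | succ n ih =>
      rw [hfs]
      have := abs_le.1 (hGb n x)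
      simp only [ContinuousMap.mul_apply, ContinuousMap.add_apply, ContinuousMap.one_apply]
      exact mul_nonneg ih (by linarith)
  -- Each new factor adds the integral of u f_k G_k, which vanishes since u f_k ∈ P (2 d_j + d_k) ⊆
  -- P (3 d_k): hence the factor 3 in `step`. The factor 2 here leaves room for products G_i G_j.
  have hsame : ∀ j, ∀ u ∈ P (2 * d j), ∀ k ≥ j, meanForm ν (u * f k) = meanForm ν (u * f j) := by
    intro j u hu k hk
    induction k, hk using Nat.le_induction with
    | base => rfl
    | succ k hk ih =>
      rw [hfs, ← ih, mul_add, mul_one, mul_add, map_add, ← mul_assoc, hG1 k, add_zero]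
      refine hmono ?_ (hmul _ _ _ _ hu (hfP k))
      have := hd.monotone hk
      omega
  have hf1 : ∀ k, meanForm ν (f k) = 1 := by
    intro k
    have := hsame 0 1 (hmono (Nat.zero_le _) hone) k (Nat.zero_le _)
    rwa [one_mul, one_mul, hf0, meanForm_one] at this
  obtain ⟨μ, hμ, hμf⟩ := exists_probability_of_eventually_const ν f hfpos hf1
  have hμu : ∀ j, ∀ u ∈ P (2 * d j), meanForm μ u = meanForm ν (u * f j) := fun j u hu =>
    hμf u _ j (hsame j u hu)
  refine ⟨μ, hμ, ?_, fun K => ⟨d K, hd.le_apply, f K, hgood K, fun u hu =>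
    hμu K u (hmono (by omega) hu)⟩⟩
  have hmean : ∀ i, meanForm μ (G i) = c := by
    intro i
    -- The first term integrates to 0 and the second to c times the integral of f_i, that is c.
    have e : G i * (f i * (1 + G i)) = f i * G i + f i * G i ^ 2 := by ring
    have hfi : f i ∈ P (3 * d i) := hmono (by omega) (hfP i)
    rw [hμu (i + 1) _ (hmono (by omega) (hGPn i)), hfs, e, map_add, hG1 i _ hfi, hG2 i _ hfi, hf1]
    ring
  refine mutuallySingular_of_means μ ν G hc hc1 hGb ?_ hmean ?_
  · intro i j hij
    refine hG1 j _ (hmono ?_ (hGPn i))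
    have := hd.monotone (Nat.succ_le_of_lt hij)
    simp only [Nat.succ_eq_add_one] at this
    omega
  · intro i j hij
    have hdij : d (i + 1) ≤ d j := hd.monotone (Nat.succ_le_of_lt hij)
    have hdj := hds j
    -- Same expansion with G_i f_j as the low-degree factor; what remains is c times the μ-mean of
    -- G_i, that is c².
    have e : G i * G j * (f j * (1 + G j)) = (G i * f j) * G j + (G i * f j) * G j ^ 2 := by ring
    have hu : G i * f j ∈ P (3 * d j) := hmono (by omega) (hmul _ _ _ _ (hGPn i) (hfP j))
    rw [hμu (j + 1) _ (hmono (by omega) (hmul _ _ _ _ (hGPn i) (hGPn j))), hfs, e, map_add,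
      hG1 j _ hu, hG2 j _ hu, ← hμu j _ (hmono (by omega) (hGPn i)), hmean]
    ring

end AbstractRiesz

/-! ### Rudin-Shapiro polynomials along dyadic characters -/

/-- The coefficients of the `k`-th pair of Rudin-Shapiro polynomials (indices below `2 ^ k` are
relevant). -/
noncomputable def rudinShapiro : ℕ → (ℕ → ℝ) × (ℕ → ℝ)
  | 0 => (fun _ => 1, fun _ => 1)
  | k + 1 => (fun n => if n < 2 ^ k then (rudinShapiro k).1 n else (rudinShapiro k).2 (n - 2 ^ k),
      fun n => if n < 2 ^ k then (rudinShapiro k).1 n else -(rudinShapiro k).2 (n - 2 ^ k))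

theorem abs_rudinShapiro (k n : ℕ) :
    |(rudinShapiro k).1 n| = 1 ∧ |(rudinShapiro k).2 n| = 1 := by
  induction k generalizing n with
  | zero => simp [rudinShapiro]
  | succ k ih =>
    simp only [rudinShapiro]
    split_ifs
    · exact ⟨(ih n).1, (ih n).1⟩
    · exact ⟨(ih _).2, by rw [abs_neg]; exact (ih _).2⟩

/-- A unimodular sequence that is multiplicative along the top binary digit, such as the values at
a point of the Walsh functions or of the exponentials. -/
structure IsDyadicCharacter (e : ℕ → ℂ) : Prop where
  norm_eq : ∀ n, ‖e n‖ = 1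
  add_two_pow : ∀ j n, n < 2 ^ j → e (n + 2 ^ j) = e n * e (2 ^ j)

theorem sum_range_ite_lt (e : ℕ → ℂ) (a b : ℕ → ℝ) {k N : ℕ} (hN : 2 ^ k ≤ N)
    (he : ∀ n < N - 2 ^ k, e (n + 2 ^ k) = e n * e (2 ^ k)) :
    ∑ n ∈ Finset.range N, ((if n < 2 ^ k then a n else b (n - 2 ^ k) : ℝ) : ℂ) * e n
      = ∑ n ∈ Finset.range (2 ^ k), (a n : ℂ) * e n
        + e (2 ^ k) * ∑ n ∈ Finset.range (N - 2 ^ k), (b n : ℂ) * e n := by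
  obtain ⟨M, rfl⟩ := Nat.exists_eq_add_of_le hN
  rw [Finset.sum_range_add, Nat.add_sub_cancel_left, Finset.mul_sum]
  congr 1
  · exact Finset.sum_congr rfl fun n hn => by rw [if_pos (Finset.mem_range.1 hn)]
  · refine Finset.sum_congr rfl fun n hn => ?_
    rw [if_neg (by omega), Nat.add_sub_cancel_left, add_comm (2 ^ k) n,
      he n (by simpa using hn)]
    ring

theorem sum_rudinShapiro_succ {e : ℕ → ℂ} (he : IsDyadicCharacter e) {k N : ℕ} (hN : 2 ^ k ≤ N)
    (hN' : N ≤ 2 ^ (k + 1)) :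
    ∑ n ∈ Finset.range N, ((rudinShapiro (k + 1)).1 n : ℂ) * e n
      = ∑ n ∈ Finset.range (2 ^ k), ((rudinShapiro k).1 n : ℂ) * e n
        + e (2 ^ k) * ∑ n ∈ Finset.range (N - 2 ^ k), ((rudinShapiro k).2 n : ℂ) * e n ∧
    ∑ n ∈ Finset.range N, ((rudinShapiro (k + 1)).2 n : ℂ) * e n
      = ∑ n ∈ Finset.range (2 ^ k), ((rudinShapiro k).1 n : ℂ) * e n
        - e (2 ^ k) * ∑ n ∈ Finset.range (N - 2 ^ k), ((rudinShapiro k).2 n : ℂ) * e n := by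
  have h : ∀ n < N - 2 ^ k, e (n + 2 ^ k) = e n * e (2 ^ k) := fun n hn =>
    he.add_two_pow k n (by rw [pow_succ] at hN'; omega)
  refine ⟨sum_range_ite_lt e _ _ hN h, ?_⟩
  refine (sum_range_ite_lt e (rudinShapiro k).1 (fun n => -(rudinShapiro k).2 n) hN h).trans ?_
  simp [Finset.sum_neg_distrib, sub_eq_add_neg]

/-- The recursion sends (P, Q) to P ± e(2^k) Q, so the parallelogram law doubles the sum of squares.
-/
theorem rudinShapiro_norm_sq {e : ℕ → ℂ} (he : IsDyadicCharacter e) (k : ℕ) :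
    ‖∑ n ∈ Finset.range (2 ^ k), ((rudinShapiro k).1 n : ℂ) * e n‖ ^ 2
      + ‖∑ n ∈ Finset.range (2 ^ k), ((rudinShapiro k).2 n : ℂ) * e n‖ ^ 2 = 2 ^ (k + 1) := by
  induction k with
  | zero => simp [rudinShapiro, he.norm_eq]; norm_num
  | succ k ih =>
    have h := sum_rudinShapiro_succ he (k := k) (N := 2 ^ (k + 1))
      (Nat.pow_le_pow_right (by norm_num) (by omega)) le_rfl
    have h2 : 2 ^ (k + 1) - 2 ^ k = 2 ^ k := by rw [pow_succ]; omega
    rw [h.1, h.2, h2]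
    have h3 := parallelogram_law_with_norm ℝ
      (∑ n ∈ Finset.range (2 ^ k), ((rudinShapiro k).1 n : ℂ) * e n)
      (e (2 ^ k) * ∑ n ∈ Finset.range (2 ^ k), ((rudinShapiro k).2 n : ℂ) * e n)
    rw [norm_mul, he.norm_eq, one_mul] at h3
    rw [pow_succ 2 (k + 1), ← ih]
    linarith

/-- Past the midpoint, the complete first half costs √2 · √2^k by the pointwise identity, and the
rest is a partial sum of the previous level. The constant 4 closes the induction because √2 + 4 ≤
4√2. -/
theorem norm_sum_rudinShapiro_le {e : ℕ → ℂ} (he : IsDyadicCharacter e) (k N : ℕ)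
    (hN : N ≤ 2 ^ k) :
    ‖∑ n ∈ Finset.range N, ((rudinShapiro k).1 n : ℂ) * e n‖ ≤ 4 * √2 ^ k ∧
    ‖∑ n ∈ Finset.range N, ((rudinShapiro k).2 n : ℂ) * e n‖ ≤ 4 * √2 ^ k := by
  have hs : √2 ^ 2 = 2 := Real.sq_sqrt (by norm_num)
  have hs0 : 0 < √2 := by positivity
  have hs1 : (1.4 : ℝ) < √2 := Real.lt_sqrt_of_sq_lt (by norm_num)
  have hs2 : √2 < 1.5 := by nlinarith
  induction k generalizing N with
  | zero =>
    have : N = 0 ∨ N = 1 := by simp at hN; omega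
    rcases this with rfl | rfl <;> simp [rudinShapiro, he.norm_eq]
  | succ k ih =>
    have hpos : 0 < √2 ^ k := by positivity
    have hpow : √2 ^ (k + 1) = √2 ^ k * √2 := pow_succ _ _
    rcases lt_or_ge N (2 ^ k) with h | h
    · have h1 : 4 * √2 ^ k ≤ 4 * √2 ^ (k + 1) := by rw [hpow]; nlinarith
      have key : ∀ n ∈ Finset.range N, n < 2 ^ k := fun n hn => (Finset.mem_range.1 hn).trans h
      have e1 : ∑ n ∈ Finset.range N, ((rudinShapiro (k + 1)).1 n : ℂ) * e n
          = ∑ n ∈ Finset.range N, ((rudinShapiro k).1 n : ℂ) * e n :=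
        Finset.sum_congr rfl fun n hn => by simp only [rudinShapiro, if_pos (key n hn)]
      have e2 : ∑ n ∈ Finset.range N, ((rudinShapiro (k + 1)).2 n : ℂ) * e n
          = ∑ n ∈ Finset.range N, ((rudinShapiro k).1 n : ℂ) * e n :=
        Finset.sum_congr rfl fun n hn => by simp only [rudinShapiro, if_pos (key n hn)]
      rw [e1, e2]
      exact ⟨(ih N h.le).1.trans h1, (ih N h.le).1.trans h1⟩
    · rw [(sum_rudinShapiro_succ he h hN).1, (sum_rudinShapiro_succ he h hN).2]
      have h3 := (ih (N - 2 ^ k) (by rw [pow_succ] at hN; omega)).2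
      have h4 : ‖∑ n ∈ Finset.range (2 ^ k), ((rudinShapiro k).1 n : ℂ) * e n‖
          ≤ √2 * √2 ^ k := by
        refine abs_le_of_sq_le_sq' ?_ (by positivity) |>.2
        have h6 : (√2 * √2 ^ k) ^ 2 = 2 ^ (k + 1) := by
          rw [← pow_succ', ← pow_mul, mul_comm (k + 1), pow_mul, hs]
        rw [h6, ← rudinShapiro_norm_sq he k]
        nlinarith [sq_nonneg ‖∑ n ∈ Finset.range (2 ^ k), ((rudinShapiro k).2 n : ℂ) * e n‖]
      have h5 : √2 * √2 ^ k + 4 * √2 ^ k ≤ 4 * √2 ^ (k + 1) := by rw [hpow]; nlinarith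
      have h7 : ‖e (2 ^ k) * ∑ n ∈ Finset.range (N - 2 ^ k), ((rudinShapiro k).2 n : ℂ) * e n‖
          ≤ 4 * √2 ^ k := by rwa [norm_mul, he.norm_eq, one_mul]
      exact ⟨(norm_add_le _ _).trans (by linarith), (norm_sub_le _ _).trans (by linarith)⟩

/-! ### Normalized high-frequency blocks -/

/-- The common size of the coefficients of the normalized Rudin-Shapiro blocks. -/
noncomputable def blockScale (k : ℕ) : ℝ≥0 := (32 * NNReal.sqrt 2 ^ k)⁻¹

theorem blockScale_pos (k : ℕ) : 0 < blockScale k := by unfold blockScale; positivity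

theorem coe_blockScale (k : ℕ) : (blockScale k : ℝ) = (32 * √2 ^ k)⁻¹ := by
  simp [blockScale, Real.coe_sqrt]

theorem blockScale_sq (k : ℕ) : blockScale k ^ 2 * 2 ^ k = 1 / 1024 := by
  have h : (NNReal.sqrt 2 ^ k) ^ 2 = 2 ^ k := by
    rw [← pow_mul, mul_comm, pow_mul, NNReal.sq_sqrt]
  rw [blockScale, inv_pow, mul_pow, h, mul_inv, mul_assoc,
    inv_mul_cancel₀ (by positivity)]
  norm_num

theorem tendsto_blockScale : Tendsto blockScale atTop (𝓝 0) := by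
  have h : blockScale = fun k => 32⁻¹ * (NNReal.sqrt 2)⁻¹ ^ k := by
    funext k; simp [blockScale, inv_pow, mul_comm]
  rw [h, ← mul_zero (32⁻¹ : ℝ≥0)]
  refine Tendsto.const_mul _ (NNReal.tendsto_pow_atTop_nhds_zero_of_lt_one ?_)
  refine inv_lt_one_of_one_lt₀ ?_
  rw [← NNReal.sqrt_one]
  exact NNReal.sqrt_lt_sqrt.2 (by norm_num)

/-- With s = `blockScale k`, s² 2^k is constant, so the quantity is a constant times ψ(as)/(as)².
This is the only use of the decay of ψ. -/
theorem tendsto_two_pow_mul_psi (ψ : ℝ≥0 → ℝ≥0) (hψ0 : ψ 0 = 0)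
    (hlim : Tendsto (fun x : ℝ≥0 => ψ x / x ^ 2) (𝓝[>] 0) (𝓝 0)) (a : ℝ≥0) :
    Tendsto (fun k => 2 ^ k * ψ (a * blockScale k)) atTop (𝓝 0) := by
  rcases eq_zero_or_pos a with rfl | ha
  · simp [hψ0]
  · have h1 : Tendsto (fun k => a * blockScale k) atTop (𝓝[>] 0) := by
      refine tendsto_nhdsWithin_iff.2 ⟨?_, Eventually.of_forall fun k =>
        mul_pos ha (blockScale_pos k)⟩
      simpa using tendsto_blockScale.const_mul a
    have h2 := (hlim.comp h1).const_mul (a ^ 2 / 1024)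
    rw [mul_zero] at h2
    refine h2.congr fun k => ?_
    have h3 := blockScale_sq k
    have h4 := (blockScale_pos k).ne'
    simp only [Function.comp]
    have h5 : (a ^ 2 / 1024 : ℝ≥0) = a ^ 2 * (blockScale k ^ 2 * 2 ^ k) := by
      rw [h3]; ring
    rw [h5]
    field_simp

/-- The coefficients of a normalized pair of Rudin-Shapiro polynomials moved to the frequency
blocks beginning at `2 ^ A` and `2 ^ (A + 1)`. -/
noncomputable def blockCoeff (k A n : ℕ) : ℝ :=
  blockScale k * ((if 2 ^ A ≤ n ∧ n < 2 ^ A + 2 ^ k then (rudinShapiro k).1 (n - 2 ^ A) else 0)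
    + if 2 ^ (A + 1) ≤ n ∧ n < 2 ^ (A + 1) + 2 ^ k then (rudinShapiro k).2 (n - 2 ^ (A + 1)) else 0)

/-- A finite set that contains the support of `blockCoeff k A`. -/
def blockSupport (k A : ℕ) : Finset ℕ :=
  Finset.Ico (2 ^ A) (2 ^ A + 2 ^ k) ∪ Finset.Ico (2 ^ (A + 1)) (2 ^ (A + 1) + 2 ^ k)

theorem card_blockSupport_le (k A : ℕ) : (blockSupport k A).card ≤ 2 * 2 ^ k := by
  refine (Finset.card_union_le _ _).trans ?_
  simp; omega

theorem blockCoeff_eq_zero {k A n : ℕ} (h : n ∉ blockSupport k A) : blockCoeff k A n = 0 := by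
  simp only [blockSupport, Finset.mem_union, Finset.mem_Ico, not_or] at h
  simp [blockCoeff, if_neg h.1, if_neg h.2]

theorem blockSupport_bounds {k A n : ℕ} (hk : k ≤ A) (h : n ∈ blockSupport k A) :
    2 ^ A ≤ n ∧ n < 2 ^ (A + 2) := by
  simp only [blockSupport, Finset.mem_union, Finset.mem_Ico] at h
  have := Nat.pow_le_pow_right (n := 2) (by norm_num) hk
  rw [pow_succ] at h
  rw [pow_add]
  omega

theorem abs_blockCoeff_le {k A : ℕ} (hk : k ≤ A) (n : ℕ) : |blockCoeff k A n| ≤ blockScale k := by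
  have h1 := abs_rudinShapiro k
  have h2 := Nat.pow_le_pow_right (n := 2) (by norm_num) hk
  have h3 : 2 ^ (A + 1) = 2 * 2 ^ A := pow_succ' _ _
  rw [blockCoeff, abs_mul, abs_of_nonneg (blockScale k).coe_nonneg]
  refine mul_le_of_le_one_right (blockScale k).coe_nonneg ?_
  split_ifs
  · omega
  · simp [(h1 _).1]
  · simp [(h1 _).2]
  · simp

/-- Truncated subtraction makes `N - M` zero before the block, and `min` freezes the sum after it.
-/
theorem sum_range_ite_Ico (a : ℕ → ℝ) (e : ℕ → ℂ) (M L N : ℕ)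
    (he : ∀ n < L, e (n + M) = e n * e M) :
    ∑ n ∈ Finset.range N, ((if M ≤ n ∧ n < M + L then a (n - M) else 0 : ℝ) : ℂ) * e n
      = e M * ∑ n ∈ Finset.range (min (N - M) L), (a n : ℂ) * e n := by
  have h1 : ∀ n, ((if M ≤ n ∧ n < M + L then a (n - M) else 0 : ℝ) : ℂ) * e n
      = if M ≤ n ∧ n < M + L then (a (n - M) : ℂ) * e n else 0 := by
    intro n; split_ifs <;> simp
  simp_rw [h1]
  rw [← Finset.sum_filter]
  have h2 : (Finset.range N).filter (fun n => M ≤ n ∧ n < M + L)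
      = Finset.Ico M (M + min (N - M) L) := by
    ext n; simp only [Finset.mem_filter, Finset.mem_range, Finset.mem_Ico]; omega
  rw [h2, Finset.sum_Ico_eq_sum_range, Nat.add_sub_cancel_left, Finset.mul_sum]
  refine Finset.sum_congr rfl fun n hn => ?_
  rw [Nat.add_sub_cancel_left, add_comm M n, he n (by simp at hn; omega)]
  ring

theorem sum_blockCoeff {e : ℕ → ℂ} (he : IsDyadicCharacter e) {k A : ℕ} (hk : k ≤ A) (N : ℕ) :
    ∑ n ∈ Finset.range N, (blockCoeff k A n : ℂ) * e n
      = blockScale k * (e (2 ^ A) * ∑ n ∈ Finset.range (min (N - 2 ^ A) (2 ^ k)),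
          ((rudinShapiro k).1 n : ℂ) * e n
        + e (2 ^ (A + 1)) * ∑ n ∈ Finset.range (min (N - 2 ^ (A + 1)) (2 ^ k)),
          ((rudinShapiro k).2 n : ℂ) * e n) := by
  have h2 := Nat.pow_le_pow_right (n := 2) (by norm_num) hk
  have h3 : 2 ^ (A + 1) = 2 * 2 ^ A := pow_succ' _ _
  rw [← sum_range_ite_Ico _ e _ _ _ fun n hn => he.add_two_pow A n (by omega),
    ← sum_range_ite_Ico _ e _ _ _ fun n hn => he.add_two_pow (A + 1) n (by omega),
    ← Finset.sum_add_distrib, Finset.mul_sum]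
  refine Finset.sum_congr rfl fun n _ => ?_
  rw [blockCoeff]; push_cast; ring

/-- Two partial sums of size at most 4 √2^k, scaled by 1/(32 √2^k). -/
theorem norm_sum_blockCoeff_le {e : ℕ → ℂ} (he : IsDyadicCharacter e) {k A : ℕ} (hk : k ≤ A)
    (N : ℕ) : ‖∑ n ∈ Finset.range N, (blockCoeff k A n : ℂ) * e n‖ ≤ 1 / 4 := by
  rw [sum_blockCoeff he hk, norm_mul]
  have h1 := (norm_sum_rudinShapiro_le he k _ (min_le_right (N - 2 ^ A) (2 ^ k))).1
  have h2 := (norm_sum_rudinShapiro_le he k _ (min_le_right (N - 2 ^ (A + 1)) (2 ^ k))).2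
  have h3 : ‖((blockScale k : ℝ) : ℂ)‖ = (32 * √2 ^ k)⁻¹ := by
    rw [← coe_blockScale, Complex.norm_real, Real.norm_of_nonneg (blockScale k).coe_nonneg]
  have h4 : 0 < √2 ^ k := by positivity
  rw [h3, inv_mul_le_iff₀ (by positivity)]
  refine (norm_add_le _ _).trans ?_
  rw [norm_mul, norm_mul, he.norm_eq, he.norm_eq, one_mul, one_mul]
  linarith

/-! ### Walsh polynomials on the Cantor group -/

theorem continuous_walsh (n : ℕ) : Continuous (walsh n) := by
  unfold walsh
  refine continuous_finsetProd _ fun j _ => ?_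
  exact (continuous_of_discreteTopology (f := fun u : ℤˣ => ((u : ℤ) : ℝ))).comp
    (continuous_apply j)

/-- The Walsh function `w_n` as a continuous function. -/
noncomputable def walshMap (n : ℕ) : C(CantorGroup, ℝ) := ⟨walsh n, continuous_walsh n⟩

@[simp] theorem walshMap_apply (n : ℕ) (x : CantorGroup) : walshMap n x = walsh n x := rfl

theorem walsh_eq_prod_range {n M : ℕ} (h : n < 2 ^ M) (x : CantorGroup) :
    walsh n x = ∏ j ∈ Finset.range M, if n.testBit j then ((x j : ℤ) : ℝ) else 1 := by
  rw [walsh, ← Finset.prod_filter]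
  refine Finset.prod_congr ?_ fun _ _ => rfl
  ext j
  simp only [List.mem_toFinset, Nat.mem_bitIndices, Finset.mem_filter, Finset.mem_range]
  refine ⟨fun hj => ⟨?_, hj⟩, fun hj => hj.2⟩
  by_contra hM
  rw [Nat.testBit_lt_two_pow (h.trans_le (Nat.pow_le_pow_right (by norm_num) (by omega)))] at hj
  exact absurd hj (by simp)

theorem walsh_xor (a b : ℕ) (x : CantorGroup) : walsh (a ^^^ b) x = walsh a x * walsh b x := by
  have ha : a < 2 ^ (a + b) :=
    Nat.lt_two_pow_self.trans_le (Nat.pow_le_pow_right (by norm_num) (by omega))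
  have hb : b < 2 ^ (a + b) :=
    Nat.lt_two_pow_self.trans_le (Nat.pow_le_pow_right (by norm_num) (by omega))
  rw [walsh_eq_prod_range ha, walsh_eq_prod_range hb, walsh_eq_prod_range (Nat.xor_lt_two_pow ha hb),
    ← Finset.prod_mul_distrib]
  refine Finset.prod_congr rfl fun j _ => ?_
  rw [Nat.testBit_xor]
  have h1 : ((x j : ℤ) : ℝ) * ((x j : ℤ) : ℝ) = 1 := by
    rcases Int.units_eq_one_or (x j) with h | h <;> simp [h]
  cases a.testBit j <;> cases b.testBit j <;> simp [h1]

theorem walsh_zero (x : CantorGroup) : walsh 0 x = 1 := by simp [walsh]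

theorem walsh_mul_self (n : ℕ) (x : CantorGroup) : walsh n x * walsh n x = 1 := by
  rw [← walsh_xor, Nat.xor_self, walsh_zero]

theorem abs_walsh (n : ℕ) (x : CantorGroup) : |walsh n x| = 1 := by
  have := walsh_mul_self n x
  rw [← abs_mul_abs_self] at this
  nlinarith [abs_nonneg (walsh n x)]

theorem add_two_pow_eq_xor {n j : ℕ} (h : n < 2 ^ j) : n + 2 ^ j = n ^^^ 2 ^ j := by
  have h1 := Nat.two_pow_add_eq_or_of_lt h 1
  rw [mul_one] at h1
  rw [add_comm, h1]
  refine Nat.eq_of_testBit_eq fun i => ?_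
  rw [Nat.testBit_or, Nat.testBit_xor, Nat.testBit_two_pow]
  by_cases hij : j = i
  · subst hij
    rw [Nat.testBit_lt_two_pow h]; simp
  · simp [hij]

theorem isDyadicCharacter_walsh (x : CantorGroup) :
    IsDyadicCharacter fun n => ((walsh n x : ℝ) : ℂ) where
  norm_eq n := by rw [Complex.norm_real, Real.norm_eq_abs, abs_walsh]
  add_two_pow j n h := by rw [add_two_pow_eq_xor h, walsh_xor]; push_cast; rfl

theorem walshMap_mul (a b : ℕ) : walshMap a * walshMap b = walshMap (a ^^^ b) := by
  ext x; simp [walsh_xor]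

theorem walshMap_zero : walshMap 0 = 1 := by
  ext x; simp [walsh_zero]

instance : IsProbabilityMeasure cantorHaar := by unfold cantorHaar; infer_instance

theorem integral_walsh {n : ℕ} (hn : n ≠ 0) : ∫ x, walsh n x ∂cantorHaar = 0 := by
  have h := integral_restrict_infinitePi (fun _ : ℕ => signMeasure) (s := n.bitIndices.toFinset)
    (f := fun y => ∏ j, ((y j : ℤ) : ℝ)) (Measurable.of_discrete).aestronglyMeasurable
  have h2 : ∀ x : CantorGroup, walsh n x
      = ∏ j, (((n.bitIndices.toFinset.restrict x) j : ℤ) : ℝ) := fun x => by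
    rw [walsh, ← Finset.prod_coe_sort]; rfl
  simp_rw [cantorHaar, h2, h]
  rw [integral_fintype_prod_eq_prod (𝕜 := ℝ) (fun _ (u : ℤˣ) => ((u : ℤ) : ℝ))]
  have hne : n.bitIndices.toFinset.Nonempty := by
    rw [Finset.nonempty_iff_ne_empty]
    intro h0
    have := Finset.sum_toFinset_bitIndices_two_pow n
    rw [h0] at this
    exact hn (by simpa using this.symm)
  obtain ⟨j, hj⟩ := hne
  refine Finset.prod_eq_zero (Finset.mem_univ ⟨j, hj⟩) ?_
  rw [signMeasure, integral_smul_measure, integral_add_measure (by simp)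
    (by simp)]
  simp

theorem meanForm_walshMap {n : ℕ} (hn : n ≠ 0) : meanForm cantorHaar (walshMap n) = 0 :=
  integral_walsh hn

/-- The Walsh polynomials of degree less than `2 ^ D`. -/
noncomputable def walshSpan (D : ℕ) : Submodule ℝ C(CantorGroup, ℝ) :=
  Submodule.span ℝ (walshMap '' {n | n < 2 ^ D})

theorem walshMap_mem {n D : ℕ} (h : n < 2 ^ D) : walshMap n ∈ walshSpan D :=
  Submodule.subset_span ⟨n, h, rfl⟩

theorem walshSpan_mono : Monotone walshSpan := fun _ _ h =>
  Submodule.span_mono (Set.image_mono fun _ hn =>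
    lt_of_lt_of_le hn (Nat.pow_le_pow_right (by norm_num) h))

theorem walshSpan_mul {D : ℕ} {u v : C(CantorGroup, ℝ)} (hu : u ∈ walshSpan D)
    (hv : v ∈ walshSpan D) : u * v ∈ walshSpan D := by
  have h := Submodule.mul_mem_mul hu hv
  rw [walshSpan, Submodule.span_mul_span] at h
  refine Submodule.span_mono ?_ h
  rintro _ ⟨_, ⟨a, ha, rfl⟩, _, ⟨b, hb, rfl⟩, rfl⟩
  exact ⟨a ^^^ b, Nat.xor_lt_two_pow ha hb, (walshMap_mul a b).symm⟩

theorem meanForm_mul_walshMap {D n : ℕ} (hn : 2 ^ D ≤ n) {u : C(CantorGroup, ℝ)}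
    (hu : u ∈ walshSpan D) : meanForm cantorHaar (u * walshMap n) = 0 := by
  induction hu using Submodule.span_induction with
  | mem u hu =>
    obtain ⟨a, ha, rfl⟩ := hu
    rw [walshMap_mul]
    refine meanForm_walshMap fun h => ?_
    have := Nat.xor_eq_zero_iff.1 h
    simp only [Set.mem_ofPred_eq] at ha
    omega
  | zero => simp
  | add u v _ _ hu hv => rw [add_mul, map_add, hu, hv, add_zero]
  | smul c u _ hu => rw [smul_mul_assoc, map_smul, hu, smul_zero]

/-- The Walsh polynomial with the coefficients `blockCoeff k A`. -/
noncomputable def walshBlock (k A : ℕ) : C(CantorGroup, ℝ) :=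
  ∑ n ∈ Finset.range (2 ^ (A + 2)), blockCoeff k A n • walshMap n

theorem walshBlock_mem (k A : ℕ) : walshBlock k A ∈ walshSpan (A + 2) :=
  Submodule.sum_mem _ fun _ hn => Submodule.smul_mem _ _ (walshMap_mem (Finset.mem_range.1 hn))

theorem abs_sum_blockCoeff_walsh_le {k A : ℕ} (hk : k ≤ A) (N : ℕ) (x : CantorGroup) :
    |∑ n ∈ Finset.range N, blockCoeff k A n * walsh n x| ≤ 1 / 4 := by
  have h := norm_sum_blockCoeff_le (isDyadicCharacter_walsh x) hk N
  rw [← Real.norm_eq_abs, ← Complex.norm_real]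
  push_cast
  exact h

theorem walshBlock_apply (k A : ℕ) (x : CantorGroup) :
    walshBlock k A x = ∑ n ∈ Finset.range (2 ^ (A + 2)), blockCoeff k A n * walsh n x := by
  simp [walshBlock]

theorem meanForm_mul_walshBlock {k A D : ℕ} (hk : k ≤ A) (hD : D ≤ A) {u : C(CantorGroup, ℝ)}
    (hu : u ∈ walshSpan D) : meanForm cantorHaar (u * walshBlock k A) = 0 := by
  rw [walshBlock, Finset.mul_sum, map_sum]
  refine Finset.sum_eq_zero fun n _ => ?_
  rw [mul_smul_comm, map_smul]
  by_cases hn : n ∈ blockSupport k A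
  · rw [meanForm_mul_walshMap ((Nat.pow_le_pow_right (by norm_num) hD).trans
      (blockSupport_bounds hk hn).1) hu, smul_zero]
  · rw [blockCoeff_eq_zero hn, zero_smul]

/-- The squares of the two halves add up to s² · 2^(k+1) = 1/512, where s = `blockScale k`. The
cross term is p q times a Walsh function of index at least 2^A, hence orthogonal to u. -/
theorem meanForm_mul_walshBlock_sq {k A D : ℕ} (hk : k ≤ A) (hD : D ≤ A) {u : C(CantorGroup, ℝ)}
    (hu : u ∈ walshSpan D) :
    meanForm cantorHaar (u * walshBlock k A ^ 2) = 1 / 512 * meanForm cantorHaar u := by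
  set p : C(CantorGroup, ℝ) := ∑ n ∈ Finset.range (2 ^ k), (rudinShapiro k).1 n • walshMap n with hp
  set q : C(CantorGroup, ℝ) := ∑ n ∈ Finset.range (2 ^ k), (rudinShapiro k).2 n • walshMap n with hq
  have hpm : p ∈ walshSpan A := walshSpan_mono hk <| Submodule.sum_mem _ fun _ hn =>
    Submodule.smul_mem _ _ (walshMap_mem (Finset.mem_range.1 hn))
  have hqm : q ∈ walshSpan A := walshSpan_mono hk <| Submodule.sum_mem _ fun _ hn =>
    Submodule.smul_mem _ _ (walshMap_mem (Finset.mem_range.1 hn))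
  have h2 := Nat.pow_le_pow_right (n := 2) (by norm_num) hk
  have h3 : 2 ^ (A + 1) = 2 * 2 ^ A := pow_succ' _ _
  have h4 : 2 ^ (A + 2) = 4 * 2 ^ A := by ring
  have hs : ((blockScale k : ℝ) ^ 2 * 2 ^ k) = 1 / 1024 := by
    simpa using congrArg ((↑) : ℝ≥0 → ℝ) (blockScale_sq k)
  have e : walshBlock k A ^ 2 = (1 / 512 : ℝ) • (1 : C(CantorGroup, ℝ))
      + (2 * (blockScale k : ℝ) ^ 2) • (p * q * walshMap (2 ^ A + 2 ^ (A + 1))) := by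
    ext x
    have g1 := sum_blockCoeff (isDyadicCharacter_walsh x) hk (2 ^ (A + 2))
    rw [min_eq_right (by omega), min_eq_right (by omega)] at g1
    have g2 := rudinShapiro_norm_sq (isDyadicCharacter_walsh x) k
    have g3 : walshBlock k A x = blockScale k * (walsh (2 ^ A) x * p x
        + walsh (2 ^ (A + 1)) x * q x) := by
      rw [walshBlock_apply, hp, hq]
      simp only [ContinuousMap.coe_sum, ContinuousMap.coe_smul, Finset.sum_apply, Pi.smul_apply,
        smul_eq_mul, walshMap_apply]
      exact_mod_cast g1
    have g4 : p x ^ 2 + q x ^ 2 = 2 ^ (k + 1) := by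
      rw [hp, hq]
      simp only [ContinuousMap.coe_sum, ContinuousMap.coe_smul, Finset.sum_apply, Pi.smul_apply,
        smul_eq_mul, walshMap_apply]
      rw [← g2]
      norm_cast
      rw [Real.norm_eq_abs, Real.norm_eq_abs, sq_abs, sq_abs]
    have g5 : walsh (2 ^ A + 2 ^ (A + 1)) x = walsh (2 ^ A) x * walsh (2 ^ (A + 1)) x := by
      rw [add_two_pow_eq_xor (Nat.pow_lt_pow_right (by norm_num) (by omega)), walsh_xor]
    have g6 := walsh_mul_self (2 ^ A) x
    have g7 := walsh_mul_self (2 ^ (A + 1)) x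
    simp only [ContinuousMap.pow_apply, ContinuousMap.add_apply, ContinuousMap.smul_apply,
      ContinuousMap.mul_apply, ContinuousMap.one_apply, walshMap_apply, smul_eq_mul, g3, g5]
    rw [pow_succ] at g4
    linear_combination (blockScale k : ℝ) ^ 2 * (p x ^ 2 * g6 + q x ^ 2 * g7 + g4) + 2 * hs
  rw [e, mul_add, map_add, mul_smul_comm, mul_smul_comm, map_smul, map_smul, mul_one, ← mul_assoc,
    meanForm_mul_walshMap (D := A) (by omega)
      (walshSpan_mul (walshSpan_mono hD hu) (walshSpan_mul hpm hqm))]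
  simp

/-! ### The inductive step on the Cantor group -/

theorem exists_block_scale (ψ : ℝ≥0 → ℝ≥0) (hψ0 : ψ 0 = 0)
    (hlim : Tendsto (fun x : ℝ≥0 => ψ x / x ^ 2) (𝓝[>] 0) (𝓝 0)) (a M η : ℝ≥0) (hη : 0 < η)
    {δ : ℝ} (hδ : 0 < δ) :
    ∃ k, (M : ℝ) * (a * blockScale k) ≤ δ ∧ M * 2 ^ k * ψ (a * blockScale k) < η := by
  have h1 : Tendsto (fun k => ((M * (a * blockScale k) : ℝ≥0) : ℝ)) atTop (𝓝 0) := by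
    have := (tendsto_blockScale.const_mul a).const_mul M
    rw [mul_zero, mul_zero] at this
    exact NNReal.tendsto_coe.2 this
  have h2 : Tendsto (fun k => M * (2 ^ k * ψ (a * blockScale k))) atTop (𝓝 0) := by
    have := (tendsto_two_pow_mul_psi ψ hψ0 hlim a).const_mul M
    rwa [mul_zero] at this
  obtain ⟨k, hk1, hk2⟩ := ((h1.eventually_lt_const hδ).and (h2.eventually_lt_const hη)).exists
  refine ⟨k, ?_, by rw [mul_assoc]; exact hk2⟩
  push_cast at hk1
  exact hk1.le

theorem sum_psi_le_card_mul {ι E : Type*} [DecidableEq ι] [NormedAddCommGroup E]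
    {ψ : ℝ≥0 → ℝ≥0} (hmono : Monotone ψ) (hψ0 : ψ 0 = 0) (S T : Finset ι) (β : ι → E)
    (hT : ∀ n ∉ T, β n = 0) {b : ℝ≥0} (hb : ∀ n, ‖β n‖₊ ≤ b) :
    ∑ n ∈ S, ψ ‖β n‖₊ ≤ T.card * ψ b := by
  calc ∑ n ∈ S, ψ ‖β n‖₊ = ∑ n ∈ S ∩ T, ψ ‖β n‖₊ := by
        refine (Finset.sum_subset Finset.inter_subset_left fun n hn hn' => ?_).symm
        have : n ∉ T := fun h => hn' (Finset.mem_inter.2 ⟨hn, h⟩)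
        simp [hT n this, hψ0]
    _ ≤ (S ∩ T).card • ψ b := Finset.sum_le_card_nsmul _ _ _ fun n _ => hmono (hb n)
    _ ≤ T.card * ψ b := by
        rw [nsmul_eq_mul]
        gcongr
        exact Finset.inter_subset_right

/-- The dyadic (that is, `xor`) convolution of two sequences, the first of which is truncated at
`2 ^ D`. -/
noncomputable def xorConv (D : ℕ) (α γ : ℕ → ℝ) (n : ℕ) : ℝ :=
  ∑ a ∈ Finset.range (2 ^ D), α a * γ (n ^^^ a)

theorem xor_lt_two_pow_mul_iff {D a n q : ℕ} (ha : a < 2 ^ D) :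
    n ^^^ a < 2 ^ D * q ↔ n < 2 ^ D * q := by
  rw [mul_comm, ← Nat.div_lt_iff_lt_mul (by positivity), ← Nat.div_lt_iff_lt_mul (by positivity),
    Nat.xor_div_two_pow, Nat.div_eq_of_lt ha, Nat.xor_zero]

/-- Xor with a < 2^D permutes each aligned block of 2^D indices, so at multiples of 2^D a partial
sum of the product is exactly f times the partial sum of the other factor. -/
theorem sum_xorConv_mul_walsh (D q : ℕ) (α γ : ℕ → ℝ) (x : CantorGroup) :
    ∑ n ∈ Finset.range (2 ^ D * q), xorConv D α γ n * walsh n x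
      = (∑ a ∈ Finset.range (2 ^ D), α a * walsh a x)
        * ∑ n ∈ Finset.range (2 ^ D * q), γ n * walsh n x := by
  simp_rw [xorConv, Finset.sum_mul]
  rw [Finset.sum_comm]
  refine Finset.sum_congr rfl fun a ha => ?_
  have ha' := Finset.mem_range.1 ha
  rw [Finset.mul_sum]
  refine Finset.sum_nbij' (· ^^^ a) (· ^^^ a) ?_ ?_ ?_ ?_ ?_
  · intro n hn
    exact Finset.mem_range.2 ((xor_lt_two_pow_mul_iff ha').2 (Finset.mem_range.1 hn))
  · intro n hn
    exact Finset.mem_range.2 ((xor_lt_two_pow_mul_iff ha').2 (Finset.mem_range.1 hn))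
  · intro n _; simp
  · intro n _; simp
  · intro n _
    have h1 := walsh_mul_self a x
    rw [walsh_xor]
    linear_combination (-(α a * γ (n ^^^ a) * walsh n x)) * h1

theorem nnnorm_xorConv_le (D : ℕ) (α γ : ℕ → ℝ) {s : ℝ≥0} (hγ : ∀ n, |γ n| ≤ s) (n : ℕ) :
    ‖xorConv D α γ n‖₊ ≤ (∑ a ∈ Finset.range (2 ^ D), ‖α a‖₊) * s := by
  rw [Finset.sum_mul]
  refine (nnnorm_sum_le _ _).trans (Finset.sum_le_sum fun a _ => ?_)
  rw [nnnorm_mul]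
  gcongr
  exact hγ _

/-- Walsh polynomials of degree less than `2 ^ D` with positive partial sums and small
coefficients. -/
def IsGoodWalsh (ψ : ℝ≥0 → ℝ≥0) (D : ℕ) (f : C(CantorGroup, ℝ)) : Prop :=
  ∃ α : ℕ → ℝ, (∀ n, 2 ^ D ≤ n → α n = 0) ∧
    (∀ x, f x = ∑ n ∈ Finset.range (2 ^ D), α n * walsh n x) ∧
    (∃ δ > 0, ∀ N, 0 < N → ∀ x, δ ≤ ∑ n ∈ Finset.range N, α n * walsh n x) ∧
    ∑ n ∈ Finset.range (2 ^ D), ψ ‖α n‖₊ < ψ 1 + 1 ∧ ∀ x, f x ≤ (3 / 2) ^ D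

theorem sum_range_eq_of_zero {M : Type*} [AddCommMonoid M] {f : ℕ → M} {m n : ℕ} (h : m ≤ n)
    (hf : ∀ i, m ≤ i → f i = 0) : ∑ i ∈ Finset.range n, f i = ∑ i ∈ Finset.range m, f i := by
  refine (Finset.sum_subset (Finset.range_mono h) fun i _ hi => hf i ?_).symm
  simpa using hi

theorem IsGoodWalsh.mem_walshSpan {ψ : ℝ≥0 → ℝ≥0} {D : ℕ} {f : C(CantorGroup, ℝ)}
    (h : IsGoodWalsh ψ D f) : f ∈ walshSpan D := by
  obtain ⟨α, -, hf, -⟩ := h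
  have : f = ∑ n ∈ Finset.range (2 ^ D), α n • walshMap n := by ext x; simp [hf]
  rw [this]
  exact Submodule.sum_mem _ fun _ hn =>
    Submodule.smul_mem _ _ (walshMap_mem (Finset.mem_range.1 hn))

theorem isGoodWalsh_one (ψ : ℝ≥0 → ℝ≥0) : IsGoodWalsh ψ 0 1 := by
  refine ⟨fun n => if n = 0 then 1 else 0, fun n hn => if_neg (by simp at hn; omega), fun x => by
    simp [walsh_zero], ⟨1, one_pos, fun N hN x => ?_⟩, by simp, by simp⟩
  simp [walsh_zero, hN]

theorem IsGoodWalsh.exists_mul {ψ : ℝ≥0 → ℝ≥0} (hmono : Monotone ψ) (hψ0 : ψ 0 = 0)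
    (hlim : Tendsto (fun x : ℝ≥0 => ψ x / x ^ 2) (𝓝[>] 0) (𝓝 0)) {D : ℕ} {f : C(CantorGroup, ℝ)}
    (h : IsGoodWalsh ψ D f) :
    ∃ k A, k ≤ A ∧ 3 * D ≤ A ∧ IsGoodWalsh ψ (A + 2) (f * (1 + walshBlock k A)) := by
  obtain ⟨α, hα0, hf, ⟨δ, hδ, hpos⟩, hsum, hbd⟩ := h
  set a : ℝ≥0 := ∑ n ∈ Finset.range (2 ^ D), ‖α n‖₊ with ha
  -- The product of f with the block has at most 2 · 2^k · 2^D nonzero coefficients, each at most a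
  -- s with s = `blockScale k`. The same multiplier covers the fewer than 2^D terms left over in a
  -- partial sum. The tolerance is the unused part of the strict ψ-budget.
  obtain ⟨k, hk1, hk2⟩ := exists_block_scale ψ hψ0 hlim a (2 * 2 ^ D)
    (ψ 1 + 1 - ∑ n ∈ Finset.range (2 ^ D), ψ ‖α n‖₊) (tsub_pos_of_lt hsum)
    (show 0 < δ / 4 by positivity)
  push_cast at hk1
  set A := max k (3 * D) with hA
  have hkA : k ≤ A := le_max_left _ _
  have hDA : 3 * D ≤ A := le_max_right _ _
  refine ⟨k, A, hkA, hDA, ?_⟩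
  set γ := blockCoeff k A with hγ
  set β := xorConv D α γ with hβ
  have hDA' : (2 : ℕ) ^ D ≤ 2 ^ A := Nat.pow_le_pow_right (by norm_num) (by omega)
  have hAA : (2 : ℕ) ^ A ≤ 2 ^ (A + 2) := Nat.pow_le_pow_right (by norm_num) (by omega)
  have hβs : ∀ n, ‖β n‖₊ ≤ a * blockScale k :=
    nnnorm_xorConv_le D α γ fun n => abs_blockCoeff_le hkA n
  have hβlow : ∀ n < 2 ^ D, β n = 0 := by
    intro n hn
    refine Finset.sum_eq_zero fun b hb => ?_
    rw [hγ, blockCoeff_eq_zero, mul_zero]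
    intro hmem
    have h1 := (blockSupport_bounds hkA hmem).1
    have h2 := Nat.xor_lt_two_pow hn (Finset.mem_range.1 hb)
    omega
  have hβhigh : ∀ n, 2 ^ (A + 2) ≤ n → β n = 0 := by
    intro n hn
    refine Finset.sum_eq_zero fun b hb => ?_
    rw [hγ, blockCoeff_eq_zero, mul_zero]
    intro hmem
    have h1 := (blockSupport_bounds hkA hmem).2
    have h2 := Nat.xor_lt_two_pow h1
      ((Finset.mem_range.1 hb).trans_le (hDA'.trans hAA))
    rw [Nat.xor_assoc, Nat.xor_self, Nat.xor_zero] at h2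
    omega
  have hβT : ∀ n ∉ (blockSupport k A ×ˢ Finset.range (2 ^ D)).image (fun p => p.1 ^^^ p.2),
      β n = 0 := by
    intro n hn
    refine Finset.sum_eq_zero fun b hb => ?_
    rw [hγ, blockCoeff_eq_zero, mul_zero]
    intro hmem
    refine hn (Finset.mem_image.2 ⟨(n ^^^ b, b), Finset.mem_product.2 ⟨hmem, hb⟩, ?_⟩)
    simp
  have hfx : ∀ x, δ ≤ f x := fun x => (hf x).symm ▸ hpos (2 ^ D) (by positivity) x
  refine ⟨fun n => α n + β n, fun n hn => ?_, fun x => ?_, ⟨δ / 2, by positivity, fun N hN x => ?_⟩,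
    ?_, fun x => ?_⟩
  · beta_reduce
    rw [hα0 n ((hDA'.trans hAA).trans hn), hβhigh n hn, add_zero]
  · simp only [ContinuousMap.mul_apply, ContinuousMap.add_apply, ContinuousMap.one_apply]
    obtain ⟨q, hq⟩ : 2 ^ D ∣ 2 ^ (A + 2) := pow_dvd_pow _ (by omega)
    simp_rw [add_mul, Finset.sum_add_distrib]
    rw [mul_add, mul_one, walshBlock_apply,
      sum_range_eq_of_zero (f := fun n => α n * walsh n x) (hDA'.trans hAA)
        (fun n hn => by rw [hα0 n hn, zero_mul]), ← hf, hq, hβ, sum_xorConv_mul_walsh, ← hf]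
  · simp_rw [add_mul, Finset.sum_add_distrib]
    set q := N / 2 ^ D
    have hN' : 2 ^ D * q ≤ N := Nat.mul_div_le _ _
    have hN'' : N < 2 ^ D * q + 2 ^ D := Nat.lt_mul_div_succ _ (by positivity)
    -- For q = 0 only old coefficients are summed. Otherwise all of f is present, and the sum is at
    -- least (3/4) f - δ/4 ≥ δ/2.
    rcases Nat.eq_zero_or_pos q with hq | hq
    · rw [hq] at hN''
      have : ∑ n ∈ Finset.range N, β n * walsh n x = 0 := Finset.sum_eq_zero fun n hn => by
        rw [hβlow n (by have := Finset.mem_range.1 hn; omega), zero_mul]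
      rw [this]
      linarith [hpos N hN x]
    · have hDN : 2 ^ D ≤ N := (Nat.le_mul_of_pos_right _ hq).trans hN'
      rw [sum_range_eq_of_zero hDN (fun n hn => by rw [hα0 n hn, zero_mul]), ← hf,
        ← Finset.sum_range_add_sum_Ico _ hN', hβ, sum_xorConv_mul_walsh, ← hf, ← hβ]
      have h1 : |∑ n ∈ Finset.Ico (2 ^ D * q) N, β n * walsh n x| ≤ δ / 4 := by
        refine (Finset.abs_sum_le_sum_abs _ _).trans ?_
        refine (Finset.sum_le_card_nsmul _ _ ((a : ℝ) * blockScale k) fun n _ => ?_).trans ?_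
        · rw [abs_mul, abs_walsh, mul_one]
          exact_mod_cast hβs n
        · rw [nsmul_eq_mul, Nat.card_Ico]
          refine le_trans (mul_le_mul_of_nonneg_right ?_ (by positivity)) hk1
          have : N - 2 ^ D * q ≤ 2 * 2 ^ D := by omega
          exact_mod_cast this
      have h2 := abs_le.1 (abs_sum_blockCoeff_walsh_le hkA (2 ^ D * q) x)
      have h3 := abs_le.1 h1
      nlinarith [hfx x]
  · calc ∑ n ∈ Finset.range (2 ^ (A + 2)), ψ ‖α n + β n‖₊
        ≤ ∑ n ∈ Finset.range (2 ^ (A + 2)), (ψ ‖α n‖₊ + ψ ‖β n‖₊) := by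
          -- The supports of α and β are disjoint, so no subadditivity of ψ is needed.
          refine Finset.sum_le_sum fun n _ => ?_
          rcases lt_or_ge n (2 ^ D) with hn | hn
          · simp [hβlow n hn]
          · simp [hα0 n hn]
      _ ≤ ∑ n ∈ Finset.range (2 ^ D), ψ ‖α n‖₊
          + (2 * 2 ^ D) * 2 ^ k * ψ (a * blockScale k) := by
          rw [Finset.sum_add_distrib]
          refine add_le_add (sum_range_eq_of_zero (hDA'.trans hAA)
            fun n hn => by rw [hα0 n hn, nnnorm_zero, hψ0]).le ?_
          refine (sum_psi_le_card_mul hmono hψ0 _ _ β hβT hβs).trans ?_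
          refine mul_le_mul_left ?_ _
          have h1 : ((blockSupport k A ×ˢ Finset.range (2 ^ D)).image
              (fun p => p.1 ^^^ p.2)).card ≤ 2 * 2 ^ k * 2 ^ D := by
            refine Finset.card_image_le.trans ?_
            rw [Finset.card_product, Finset.card_range]
            exact Nat.mul_le_mul_right _ (card_blockSupport_le k A)
          have h2 : 2 * 2 ^ k * 2 ^ D = 2 * 2 ^ D * 2 ^ k := by ring
          rw [h2] at h1
          exact_mod_cast h1
      _ < ψ 1 + 1 := lt_tsub_iff_left.1 hk2
  · have h2 := abs_le.1 (abs_sum_blockCoeff_walsh_le hkA (2 ^ (A + 2)) x)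
    simp only [ContinuousMap.mul_apply, ContinuousMap.add_apply, ContinuousMap.one_apply]
    rw [walshBlock_apply]
    -- The new factor is at most 5/4 and D grows by at least 1. It only matters later that 3/2 < 2.
    calc _ ≤ (3 / 2 : ℝ) ^ D * (3 / 2) := by
          refine mul_le_mul (hbd x) (by linarith) (by linarith) (by positivity)
      _ = (3 / 2) ^ (D + 1) := (pow_succ _ _).symm
      _ ≤ (3 / 2) ^ (A + 2) := pow_le_pow_right₀ (by norm_num) (by omega)

theorem walshCoeff_eq_meanForm (μ : Measure CantorGroup) [IsFiniteMeasure μ] (n : ℕ) :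
    walshCoeff μ n = meanForm μ (walshMap n) := rfl

theorem meanForm_walshMap_mul_sum (D : ℕ) (α : ℕ → ℝ) {n : ℕ} (hn : n < 2 ^ D)
    {f : C(CantorGroup, ℝ)} (hf : ∀ x, f x = ∑ n ∈ Finset.range (2 ^ D), α n * walsh n x) :
    meanForm cantorHaar (walshMap n * f) = α n := by
  have : f = ∑ n ∈ Finset.range (2 ^ D), α n • walshMap n := by ext x; simp [hf]
  rw [this, Finset.mul_sum, map_sum, Finset.sum_eq_single n]
  · rw [mul_smul_comm, walshMap_mul, Nat.xor_self, walshMap_zero, map_smul, meanForm_one]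
    simp
  · intro m _ hm
    rw [mul_smul_comm, walshMap_mul, map_smul, meanForm_walshMap, smul_zero]
    exact fun h => hm (Nat.xor_eq_zero_iff.1 h).symm
  · intro h; exact absurd (Finset.mem_range.2 hn) h

/-- A singular probability measure on the Cantor group, without atoms, with nonnegative partial
sums and small coefficients. -/
theorem exists_walsh_measure {ψ : ℝ≥0 → ℝ≥0} (hmono : Monotone ψ) (hψ0 : ψ 0 = 0)
    (hlim : Tendsto (fun x : ℝ≥0 => ψ x / x ^ 2) (𝓝[>] 0) (𝓝 0)) :
    ∃ μ : Measure CantorGroup, IsProbabilityMeasure μ ∧ μ.MutuallySingular cantorHaar ∧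
      (∀ (N : ℕ) (x : CantorGroup), 0 ≤ walshPartialSum μ N x) ∧
      Summable (fun n : ℕ => ψ ‖walshCoeff μ n‖₊) ∧
      ∀ K, ∃ D ≥ K, ∀ x, ∑ n ∈ Finset.range (2 ^ D), walshCoeff μ n * walsh n x ≤ (3 / 2) ^ D := by
  obtain ⟨μ, hμ, hsing, hμf⟩ := exists_singular_of_step cantorHaar
    (fun D => (walshSpan D : Set C(CantorGroup, ℝ)))
    (fun _ _ h => walshSpan_mono h) (walshMap_zero ▸ walshMap_mem (by norm_num))
    (fun m n u v hu hv => walshSpan_mul (walshSpan_mono (by omega) hu)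
      (walshSpan_mono (by omega) hv)) (c := 1 / 512) (by norm_num) (by norm_num)
    (IsGoodWalsh ψ) (fun D f h => h.mem_walshSpan) (isGoodWalsh_one ψ) (fun D f h => by
      obtain ⟨k, A, hk, hD, hg⟩ := h.exists_mul hmono hψ0 hlim
      refine ⟨A + 2, by omega, walshBlock k A, walshBlock_mem k A, fun x => ?_, fun u hu =>
        ⟨meanForm_mul_walshBlock hk hD hu, meanForm_mul_walshBlock_sq hk hD hu⟩, hg⟩
      rw [walshBlock_apply]
      exact (abs_sum_blockCoeff_walsh_le hk _ x).trans (by norm_num))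
  have key : ∀ K, ∃ D ≥ K, ∃ (f : C(CantorGroup, ℝ)) (α : ℕ → ℝ), (∀ n < 2 ^ D, walshCoeff μ n = α n) ∧
      (∀ x, f x = ∑ n ∈ Finset.range (2 ^ D), α n * walsh n x) ∧
      (∃ δ > 0, ∀ N, 0 < N → ∀ x, δ ≤ ∑ n ∈ Finset.range N, α n * walsh n x) ∧
      ∑ n ∈ Finset.range (2 ^ D), ψ ‖α n‖₊ < ψ 1 + 1 ∧ ∀ x, f x ≤ (3 / 2 : ℝ) ^ D := by
    intro K
    obtain ⟨D, hD, f, ⟨α, -, h1, h2⟩, hf⟩ := hμf K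
    refine ⟨D, hD, f, α, fun n hn => ?_, h1, h2⟩
    rw [walshCoeff_eq_meanForm, hf _ (walshMap_mem hn), meanForm_walshMap_mul_sum D α hn h1]
  refine ⟨μ, hμ, hsing, fun N x => ?_, ?_, fun K => ?_⟩
  · rcases Nat.eq_zero_or_pos N with rfl | hN
    · simp [walshPartialSum]
    · obtain ⟨D, hD, f, α, hα, -, ⟨δ, hδ, h⟩, -⟩ := key N
      have e : walshPartialSum μ N x = ∑ n ∈ Finset.range N, α n * walsh n x :=
        Finset.sum_congr rfl fun n hn => by
          rw [hα n ((Finset.mem_range.1 hn).trans (hD.trans_lt Nat.lt_two_pow_self))]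
      rw [e]
      exact hδ.le.trans (h N hN x)
  · refine NNReal.summable_of_sum_range_le (c := ψ 1 + 1) fun N => ?_
    obtain ⟨D, hD, f, α, hα, -, -, h, -⟩ := key N
    refine (Finset.sum_le_sum_of_subset (Finset.range_mono
      (hD.trans Nat.lt_two_pow_self.le))).trans (le_trans (le_of_eq ?_) h.le)
    exact Finset.sum_congr rfl fun n hn => by rw [hα n (Finset.mem_range.1 hn)]
  · obtain ⟨D, hD, f, α, hα, hf, -, -, h⟩ := key K
    refine ⟨D, hD, fun x => ?_⟩
    rw [Finset.sum_congr rfl fun n hn => by rw [hα n (Finset.mem_range.1 hn)], ← hf]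
    exact h x

/-! ### Trigonometric polynomials on the circle -/

section ComplexMean

variable {X : Type*} [TopologicalSpace X]

/-- A real continuous function, seen as a complex one. -/
noncomputable def toComplexMap (u : C(X, ℝ)) : C(X, ℂ) := ⟨fun x => (u x : ℂ), by fun_prop⟩

/-- The real part of a complex continuous function. -/
noncomputable def realPartMap (F : C(X, ℂ)) : C(X, ℝ) := ⟨fun x => (F x).re, by fun_prop⟩

@[simp] theorem toComplexMap_apply (u : C(X, ℝ)) (x : X) : toComplexMap u x = (u x : ℂ) := rfl

@[simp] theorem realPartMap_apply (F : C(X, ℂ)) (x : X) : realPartMap F x = (F x).re := rfl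

variable [CompactSpace X] [MeasurableSpace X] [BorelSpace X]

/-- The integral against a finite measure, as a linear form on complex continuous functions. -/
noncomputable def complexMean (ν : Measure X) [IsFiniteMeasure ν] : C(X, ℂ) →ₗ[ℂ] ℂ where
  toFun F := ∫ x, F x ∂ν
  map_add' F G := integral_add (integrable_continuousMap F ν) (integrable_continuousMap G ν)
  map_smul' c _ := integral_const_mul c _

theorem complexMean_apply (ν : Measure X) [IsFiniteMeasure ν] (F : C(X, ℂ)) :
    complexMean ν F = ∫ x, F x ∂ν := rfl

theorem meanForm_mul_realPartMap (ν : Measure X) [IsFiniteMeasure ν] (u : C(X, ℝ)) (F : C(X, ℂ)) :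
    meanForm ν (u * realPartMap F) = (complexMean ν (toComplexMap u * F)).re := by
  rw [complexMean_apply, meanForm_apply]
  have h := integral_re (𝕜 := ℂ) (integrable_continuousMap (toComplexMap u * F) ν)
  refine Eq.trans ?_ h
  refine integral_congr_ae (Eventually.of_forall fun x => ?_)
  simp

end ComplexMean

theorem complexMean_fourier {n : ℤ} (hn : n ≠ 0) :
    complexMean AddCircle.haarAddCircle (fourier n : C(UnitAddCircle, ℂ)) = 0 :=
  integral_eq_zero_of_add_right_eq_neg (fourier_add_half_inv_index hn one_pos)

theorem fourier_mul (m n : ℤ) :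
    (fourier m : C(UnitAddCircle, ℂ)) * fourier n = fourier (m + n) := by
  ext t; simp

theorem fourier_zero_eq_one : (fourier 0 : C(UnitAddCircle, ℂ)) = 1 := by
  ext t; simp

theorem complexMean_one (ν : Measure UnitAddCircle) [IsProbabilityMeasure ν] :
    complexMean ν 1 = 1 := by
  simp [complexMean_apply]

/-- The trigonometric polynomials of degree at most `D`. -/
noncomputable def trigSpan (D : ℕ) : Submodule ℂ C(UnitAddCircle, ℂ) :=
  Submodule.span ℂ (fourier '' {n : ℤ | n.natAbs ≤ D})

theorem fourier_mem_trigSpan {n : ℤ} {D : ℕ} (h : n.natAbs ≤ D) : fourier n ∈ trigSpan D :=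
  Submodule.subset_span ⟨n, h, rfl⟩

theorem trigSpan_mono : Monotone trigSpan := fun _ _ h =>
  Submodule.span_mono (Set.image_mono fun _ hn => le_trans hn h)

theorem trigSpan_mul {D D' : ℕ} {u v : C(UnitAddCircle, ℂ)} (hu : u ∈ trigSpan D)
    (hv : v ∈ trigSpan D') : u * v ∈ trigSpan (D + D') := by
  have h := Submodule.mul_mem_mul hu hv
  rw [trigSpan, trigSpan, Submodule.span_mul_span] at h
  refine Submodule.span_mono ?_ h
  rintro _ ⟨_, ⟨a, ha, rfl⟩, _, ⟨b, hb, rfl⟩, rfl⟩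
  exact ⟨a + b, (Int.natAbs_add_le a b).trans (add_le_add ha hb), (fourier_mul a b).symm⟩

theorem complexMean_mul_fourier {D : ℕ} {n : ℤ} (hn : D < n.natAbs) {u : C(UnitAddCircle, ℂ)}
    (hu : u ∈ trigSpan D) : complexMean AddCircle.haarAddCircle (u * fourier n) = 0 := by
  induction hu using Submodule.span_induction with
  | mem u hu =>
    obtain ⟨a, ha, rfl⟩ := hu
    rw [fourier_mul]
    refine complexMean_fourier fun h => ?_
    simp only [Set.mem_ofPred_eq] at ha
    omega
  | zero => simp
  | add u v _ _ hu hv => rw [add_mul, map_add, hu, hv, add_zero]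
  | smul c u _ hu => rw [smul_mul_assoc, map_smul, hu, smul_zero]

theorem isDyadicCharacter_fourier (t : UnitAddCircle) :
    IsDyadicCharacter fun n => fourier (n : ℤ) t where
  norm_eq n := by rw [fourier_apply]; exact Circle.norm_coe _
  add_two_pow j n _ := by push_cast; rw [fourier_add]

theorem norm_fourier_apply (n : ℤ) (t : UnitAddCircle) : ‖fourier n t‖ = 1 := by
  rw [fourier_apply]; exact Circle.norm_coe _

/-- Half of the analytic part of the trigonometric polynomial with coefficients `blockCoeff k A`. -/
noncomputable def analyticBlock (k A : ℕ) : C(UnitAddCircle, ℂ) :=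
  ∑ n ∈ Finset.range (2 ^ (A + 2)), (blockCoeff k A n : ℂ) • fourier (n : ℤ)

/-- The real even trigonometric polynomial with the coefficients `blockCoeff k A |n|`. -/
noncomputable def circleBlock (k A : ℕ) : C(UnitAddCircle, ℝ) :=
  realPartMap ((2 : ℂ) • analyticBlock k A)

theorem sum_Icc_neg_succ {M : Type*} [AddCommMonoid M] (F : ℤ → M) (N : ℕ) :
    ∑ n ∈ Finset.Icc (-((N + 1 : ℕ) : ℤ)) ((N + 1 : ℕ) : ℤ), F n
      = ∑ n ∈ Finset.Icc (-(N : ℤ)) (N : ℤ), F n + (F ((N + 1 : ℕ) : ℤ) + F (-((N + 1 : ℕ) : ℤ))) := by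
  have h : Finset.Icc (-((N + 1 : ℕ) : ℤ)) ((N + 1 : ℕ) : ℤ)
      = insert (((N + 1 : ℕ) : ℤ)) (insert (-((N + 1 : ℕ) : ℤ)) (Finset.Icc (-(N : ℤ)) (N : ℤ))) := by
    ext n; simp only [Finset.mem_Icc, Finset.mem_insert]; omega
  rw [h, Finset.sum_insert, Finset.sum_insert]
  · rw [← add_assoc, add_comm]
  · simp only [Finset.mem_Icc]; omega
  · simp only [Finset.mem_Icc, Finset.mem_insert]; omega

/-- The terms of index ±n are conjugate; `h0` avoids counting the index 0 twice. One-sided bounds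
thus become bounds for symmetric sums. -/
theorem sum_Icc_natAbs_fourier (γ : ℕ → ℝ) (h0 : γ 0 = 0) (N : ℕ) (t : UnitAddCircle) :
    ∑ n ∈ Finset.Icc (-(N : ℤ)) (N : ℤ), (γ n.natAbs : ℂ) * fourier n t
      = ((2 * (∑ n ∈ Finset.range (N + 1), (γ n : ℂ) * fourier (n : ℤ) t).re : ℝ) : ℂ) := by
  induction N with
  | zero => simp [h0]
  | succ N ih =>
    rw [sum_Icc_neg_succ, ih, Finset.sum_range_succ _ (N + 1), fourier_neg, Int.natAbs_neg,
      Int.natAbs_natCast, Complex.add_re, ← mul_add, Complex.add_conj, Complex.re_ofReal_mul]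
    push_cast
    ring

theorem blockCoeff_zero {k A : ℕ} (hk : k ≤ A) : blockCoeff k A 0 = 0 :=
  blockCoeff_eq_zero fun h => by
    have := (blockSupport_bounds hk h).1
    have : 0 < 2 ^ A := by positivity
    omega

theorem analyticBlock_apply (k A : ℕ) (t : UnitAddCircle) : analyticBlock k A t
    = ∑ n ∈ Finset.range (2 ^ (A + 2)), (blockCoeff k A n : ℂ) * fourier (n : ℤ) t := by
  simp [analyticBlock]

theorem circleBlock_apply {k A : ℕ} (hk : k ≤ A) (t : UnitAddCircle) :
    (circleBlock k A t : ℂ) = ∑ n ∈ Finset.Icc (-((2 ^ (A + 2) : ℕ) : ℤ)) ((2 ^ (A + 2) : ℕ) : ℤ),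
      (blockCoeff k A n.natAbs : ℂ) * fourier n t := by
  rw [sum_Icc_natAbs_fourier _ (blockCoeff_zero hk), Finset.sum_range_succ, blockCoeff_eq_zero,
    ← analyticBlock_apply]
  · simp [circleBlock]
  · intro h; exact absurd (blockSupport_bounds hk h).2 (lt_irrefl _)

theorem sum_blockCoeff_fourier {k A : ℕ} (hk : k ≤ A) (N : ℕ) (t : UnitAddCircle) :
    ∃ r : ℝ, |r| ≤ 1 / 2 ∧ ∑ n ∈ Finset.Icc (-(N : ℤ)) (N : ℤ),
      (blockCoeff k A n.natAbs : ℂ) * fourier n t = r := by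
  refine ⟨_, ?_, sum_Icc_natAbs_fourier _ (blockCoeff_zero hk) N t⟩
  have h := norm_sum_blockCoeff_le (isDyadicCharacter_fourier t) hk (N + 1)
  rw [abs_mul, abs_two]
  linarith [(Complex.abs_re_le_norm _).trans h]

theorem abs_circleBlock_le {k A : ℕ} (hk : k ≤ A) (t : UnitAddCircle) :
    |circleBlock k A t| ≤ 1 / 2 := by
  obtain ⟨r, hr, h⟩ := sum_blockCoeff_fourier hk (2 ^ (A + 2)) t
  rw [← circleBlock_apply hk] at h
  rwa [Complex.ofReal_inj.1 h]

theorem circleBlock_mem {k A : ℕ} (hk : k ≤ A) :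
    toComplexMap (circleBlock k A) ∈ trigSpan (2 ^ (A + 2)) := by
  have h : toComplexMap (circleBlock k A) = ∑ n ∈ Finset.Icc (-((2 ^ (A + 2) : ℕ) : ℤ))
      ((2 ^ (A + 2) : ℕ) : ℤ), (blockCoeff k A n.natAbs : ℂ) • fourier n := by
    ext t
    rw [toComplexMap_apply, circleBlock_apply hk]
    simp
  rw [h]
  refine Submodule.sum_mem _ fun n hn => Submodule.smul_mem _ _ (fourier_mem_trigSpan ?_)
  rw [Finset.mem_Icc] at hn
  omega

theorem meanForm_mul_circleBlock {k A D : ℕ} (hk : k ≤ A) (hD : D < 2 ^ A)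
    {u : C(UnitAddCircle, ℝ)} (hu : toComplexMap u ∈ trigSpan D) :
    meanForm AddCircle.haarAddCircle (u * circleBlock k A) = 0 := by
  rw [circleBlock, meanForm_mul_realPartMap, mul_smul_comm, map_smul, analyticBlock,
    Finset.mul_sum, map_sum, Finset.sum_eq_zero, smul_zero, Complex.zero_re]
  intro n _
  rw [mul_smul_comm, map_smul]
  by_cases hn : n ∈ blockSupport k A
  · rw [complexMean_mul_fourier (n := (n : ℤ))
      (hD.trans_le (by simpa using (blockSupport_bounds hk hn).1)) hu, smul_zero]
  · rw [blockCoeff_eq_zero hn, Complex.ofReal_zero, zero_smul]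

/-- With w = zp + z²q, this is (2 Re w)² = 2|w|² + 2 Re w². Besides |p|² + |q|², every term carries
a factor z, z², z³ or z⁴. -/
theorem two_mul_re_sq (s : ℝ) (z p q : ℂ) (hz : ‖z‖ = 1) :
    (2 * ((s : ℂ) * (z * p + z ^ 2 * q)).re) ^ 2 = 2 * s ^ 2 * (‖p‖ ^ 2 + ‖q‖ ^ 2)
      + 2 * s ^ 2 * (2 * (z * (starRingEnd ℂ p * q)) + (z * p + z ^ 2 * q) ^ 2).re := by
  have h1 : z * starRingEnd ℂ z = 1 := by
    rw [Complex.mul_conj, Complex.normSq_eq_norm_sq, hz]; norm_num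
  have h2 : (‖p‖ ^ 2 : ℂ) = p * starRingEnd ℂ p := by
    rw [Complex.mul_conj, Complex.normSq_eq_norm_sq]; push_cast; rfl
  have h3 : (‖q‖ ^ 2 : ℂ) = q * starRingEnd ℂ q := by
    rw [Complex.mul_conj, Complex.normSq_eq_norm_sq]; push_cast; rfl
  apply Complex.ofReal_injective
  push_cast
  rw [Complex.re_eq_add_conj, Complex.re_eq_add_conj, h2, h3]
  simp only [map_add, map_mul, map_pow, Complex.conj_ofReal, Complex.conj_conj, map_ofNat]
  set zb := starRingEnd ℂ z
  set pb := starRingEnd ℂ p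
  set qb := starRingEnd ℂ q
  linear_combination (2 * (s : ℂ) ^ 2 * (p * pb + zb * p * qb + z * q * pb
    + (z * zb + 1) * q * qb)) * h1

/-- The constant is 2 s² · 2^(k+1) = 1/256, with s = `blockScale k`. The other terms are products of
two polynomials of degree at most 2^k, shifted by at least 2^A; `hD` makes the shift exceed their
degree plus that of u. -/
theorem meanForm_mul_circleBlock_sq {k A D : ℕ} (hk : k ≤ A) (hD : D + 2 * 2 ^ k < 2 ^ A)
    {u : C(UnitAddCircle, ℝ)} (hu : toComplexMap u ∈ trigSpan D) :
    meanForm AddCircle.haarAddCircle (u * circleBlock k A ^ 2)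
      = 1 / 256 * meanForm AddCircle.haarAddCircle u := by
  set a := (rudinShapiro k).1
  set b := (rudinShapiro k).2
  set p : C(UnitAddCircle, ℂ) := ∑ n ∈ Finset.range (2 ^ k), (a n : ℂ) • fourier (n : ℤ) with hp
  set pb : C(UnitAddCircle, ℂ) := ∑ n ∈ Finset.range (2 ^ k), (a n : ℂ) • fourier (-(n : ℤ))
    with hpb
  set q : C(UnitAddCircle, ℂ) := ∑ n ∈ Finset.range (2 ^ k), (b n : ℂ) • fourier (n : ℤ) with hq
  have hpm : p ∈ trigSpan (2 ^ k) := Submodule.sum_mem _ fun n hn =>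
    Submodule.smul_mem _ _ (fourier_mem_trigSpan (by
      have := Finset.mem_range.1 hn; rw [Int.natAbs_natCast]; exact this.le))
  have hpbm : pb ∈ trigSpan (2 ^ k) := Submodule.sum_mem _ fun n hn =>
    Submodule.smul_mem _ _ (fourier_mem_trigSpan (by
      have := Finset.mem_range.1 hn; rw [Int.natAbs_neg, Int.natAbs_natCast]; exact this.le))
  have hqm : q ∈ trigSpan (2 ^ k) := Submodule.sum_mem _ fun n hn =>
    Submodule.smul_mem _ _ (fourier_mem_trigSpan (by
      have := Finset.mem_range.1 hn; rw [Int.natAbs_natCast]; exact this.le))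
  have h2 := Nat.pow_le_pow_right (n := 2) (by norm_num) hk
  have h3 : 2 ^ (A + 1) = 2 * 2 ^ A := pow_succ' _ _
  have h4 : 2 ^ (A + 2) = 4 * 2 ^ A := by ring
  have hs : ((blockScale k : ℝ) ^ 2 * 2 ^ k) = 1 / 1024 := by
    simpa using congrArg ((↑) : ℝ≥0 → ℝ) (blockScale_sq k)
  let M : ℤ := ((2 ^ A : ℕ) : ℤ)
  let W : C(UnitAddCircle, ℂ) := (2 : ℂ) • (pb * q * fourier M) + p * p * fourier (M + M)
    + (2 : ℂ) • (p * q * fourier (M + M + M)) + q * q * fourier (M + M + M + M)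
  have e : circleBlock k A ^ 2 = (1 / 256 : ℝ) • (1 : C(UnitAddCircle, ℝ))
      + (2 * (blockScale k : ℝ) ^ 2) • realPartMap W := by
    ext t
    have hchar := isDyadicCharacter_fourier t
    have g1 := sum_blockCoeff hchar hk (2 ^ (A + 2))
    rw [min_eq_right (by omega), min_eq_right (by omega)] at g1
    have g2 := rudinShapiro_norm_sq hchar k
    have hpt : p t = ∑ n ∈ Finset.range (2 ^ k), (a n : ℂ) * fourier (n : ℤ) t := by simp [hp]
    have hqt : q t = ∑ n ∈ Finset.range (2 ^ k), (b n : ℂ) * fourier (n : ℤ) t := by simp [hq]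
    have hpbt : pb t = starRingEnd ℂ (p t) := by
      rw [hpt, map_sum]; simp [hpb, -fourier_apply, fourier_neg]
    have hM : fourier ((2 ^ (A + 1) : ℕ) : ℤ) t = (fourier M t) ^ 2 := by
      rw [sq, ← fourier_add, h3]; congr 1; simp only [M]; push_cast; ring_nf
    have g3 : circleBlock k A t = 2 * (((blockScale k : ℝ) : ℂ)
        * (fourier M t * p t + fourier M t ^ 2 * q t)).re := by
      rw [circleBlock, realPartMap_apply, ContinuousMap.smul_apply, analyticBlock_apply, g1, hM,
        ← hpt, ← hqt]
      simp [M]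
    rw [← hpt, ← hqt] at g2
    have hW : W t = 2 * (fourier M t * (starRingEnd ℂ (p t) * q t))
        + (fourier M t * p t + fourier M t ^ 2 * q t) ^ 2 := by
      simp only [W, ContinuousMap.add_apply, ContinuousMap.smul_apply, ContinuousMap.mul_apply,
        fourier_add, hpbt, smul_eq_mul]
      ring
    rw [ContinuousMap.pow_apply, g3, two_mul_re_sq _ _ _ _ (norm_fourier_apply M t), g2, ← hW]
    simp only [ContinuousMap.add_apply, ContinuousMap.smul_apply, ContinuousMap.one_apply,
      realPartMap_apply, smul_eq_mul]
    rw [pow_succ]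
    linear_combination 4 * hs
  have hz : ∀ (v : C(UnitAddCircle, ℂ)) (n : ℤ), v ∈ trigSpan (2 ^ k + 2 ^ k) → 2 ^ A ≤ n.natAbs →
      complexMean AddCircle.haarAddCircle (toComplexMap u * (v * fourier n)) = 0 := by
    intro v n hv hn
    rw [← mul_assoc]
    exact complexMean_mul_fourier (by omega) (trigSpan_mul hu hv)
  have hM : (2 ^ A : ℕ) = M.natAbs := rfl
  have hM0 : 0 ≤ M := Int.natCast_nonneg _
  rw [e, mul_add, map_add, mul_smul_comm, mul_smul_comm, map_smul, map_smul, mul_one,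
    meanForm_mul_realPartMap]
  simp only [W, mul_add, map_add, mul_smul_comm, map_smul]
  rw [hz _ _ (trigSpan_mul hpbm hqm) (by omega), hz _ _ (trigSpan_mul hpm hpm) (by omega),
    hz _ _ (trigSpan_mul hpm hqm) (by omega), hz _ _ (trigSpan_mul hqm hqm) (by omega)]
  simp

/-! ### The inductive step on the circle -/

/-- The convolution of two sequences on `ℤ`, the first of which is truncated at `D`. -/
noncomputable def truncConv (D : ℕ) (α γ : ℤ → ℝ) (n : ℤ) : ℝ :=
  ∑ a ∈ Finset.Icc (-(D : ℤ)) (D : ℤ), α a * γ (n - a)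

theorem truncConv_neg (D : ℕ) {α γ : ℤ → ℝ} (hα : ∀ n, α (-n) = α n) (hγ : ∀ n, γ (-n) = γ n)
    (n : ℤ) : truncConv D α γ (-n) = truncConv D α γ n := by
  refine Finset.sum_nbij' (fun a => -a) (fun a => -a) ?_ ?_ (fun a _ => neg_neg a)
    (fun a _ => neg_neg a) fun a _ => ?_
  · intro a ha; simp only [Finset.mem_Icc] at ha ⊢; omega
  · intro a ha; simp only [Finset.mem_Icc] at ha ⊢; omega
  · rw [hα, ← hγ (-n - a)]; congr 2; ring

theorem nnnorm_truncConv_le (D : ℕ) (α γ : ℤ → ℝ) {s : ℝ≥0} (hγ : ∀ n, |γ n| ≤ s) (n : ℤ) :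
    ‖truncConv D α γ n‖₊ ≤ (∑ a ∈ Finset.Icc (-(D : ℤ)) (D : ℤ), ‖α a‖₊) * s := by
  rw [Finset.sum_mul]
  refine (nnnorm_sum_le _ _).trans (Finset.sum_le_sum fun a _ => ?_)
  rw [nnnorm_mul]
  gcongr
  exact hγ _

theorem sum_truncConv_mul_fourier (D N : ℕ) (α γ : ℤ → ℝ) (t : UnitAddCircle) :
    ∑ n ∈ Finset.Icc (-(N : ℤ)) (N : ℤ), (truncConv D α γ n : ℂ) * fourier n t
      = ∑ a ∈ Finset.Icc (-(D : ℤ)) (D : ℤ), (α a * fourier a t)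
        * ∑ n ∈ Finset.Icc (-(N : ℤ) - a) (N - a), (γ n : ℂ) * fourier n t := by
  simp_rw [truncConv, Complex.ofReal_sum, Finset.sum_mul]
  rw [Finset.sum_comm]
  refine Finset.sum_congr rfl fun a _ => ?_
  rw [Finset.mul_sum]
  refine Finset.sum_nbij' (fun n => n - a) (fun n => n + a) ?_ ?_ (fun n _ => by simp)
    (fun n _ => by simp) fun n _ => ?_
  · intro n hn; simp only [Finset.mem_Icc] at hn ⊢; omega
  · intro n hn; simp only [Finset.mem_Icc] at hn ⊢; omega
  · have : fourier n t = fourier a t * fourier (n - a) t := by rw [← fourier_add]; simp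
    rw [this]; push_cast; ring

/-- Multiplying by a frequency a shifts the summation window. Each of the two set differences lies
in two intervals of D integers near the endpoints. -/
theorem norm_sum_Icc_sub_le {c : ℤ → ℂ} {s : ℝ} (hc : ∀ n, ‖c n‖ ≤ s) {D N : ℕ} {a : ℤ}
    (ha : a ∈ Finset.Icc (-(D : ℤ)) (D : ℤ)) :
    ‖∑ n ∈ Finset.Icc (-(N : ℤ) - a) (N - a), c n - ∑ n ∈ Finset.Icc (-(N : ℤ)) (N : ℤ), c n‖
      ≤ 4 * D * s := by
  have hs : 0 ≤ s := (norm_nonneg _).trans (hc 0)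
  rw [Finset.mem_Icc] at ha
  have key : ∀ S T : Finset ℤ, S ⊆ T → T.card ≤ 2 * D → ‖∑ n ∈ S, c n‖ ≤ 2 * D * s := by
    intro S T hST hT
    refine (norm_sum_le_of_le _ fun n _ => hc n).trans ?_
    rw [Finset.sum_const, nsmul_eq_mul]
    refine mul_le_mul_of_nonneg_right ?_ hs
    exact_mod_cast (Finset.card_le_card hST).trans hT
  have h1 := key (Finset.Icc (-(N : ℤ) - a) (N - a) \ Finset.Icc (-(N : ℤ)) (N : ℤ))
    (Finset.Ico (-(N : ℤ) - D) (-N) ∪ Finset.Ioc (N : ℤ) (N + D)) (fun n hn => by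
      simp only [Finset.mem_sdiff, Finset.mem_Icc, Finset.mem_union, Finset.mem_Ico,
        Finset.mem_Ioc] at hn ⊢
      omega) ((Finset.card_union_le _ _).trans (by simp; omega))
  have h2 := key (Finset.Icc (-(N : ℤ)) (N : ℤ) \ Finset.Icc (-(N : ℤ) - a) (N - a))
    (Finset.Ico (-(N : ℤ)) (-N + D) ∪ Finset.Ioc (N - D : ℤ) N) (fun n hn => by
      simp only [Finset.mem_sdiff, Finset.mem_Icc, Finset.mem_union, Finset.mem_Ico,
        Finset.mem_Ioc] at hn ⊢
      omega) ((Finset.card_union_le _ _).trans (by simp; omega))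
  rw [← Finset.sum_sdiff_sub_sum_sdiff]
  refine (norm_sub_le _ _).trans ?_
  linarith

/-- Real even trigonometric polynomials of degree at most `D` with positive symmetric partial sums
and small coefficients. -/
def IsGoodTrig (ψ : ℝ≥0 → ℝ≥0) (D : ℕ) (f : C(UnitAddCircle, ℝ)) : Prop :=
  ∃ α : ℤ → ℝ, (∀ n, α (-n) = α n) ∧ (∀ n : ℤ, D < n.natAbs → α n = 0) ∧
    (∀ t, (f t : ℂ) = ∑ n ∈ Finset.Icc (-(D : ℤ)) (D : ℤ), (α n : ℂ) * fourier n t) ∧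
    (∃ δ > 0, ∀ (N : ℕ) (t : UnitAddCircle),
      δ ≤ (∑ n ∈ Finset.Icc (-(N : ℤ)) (N : ℤ), (α n : ℂ) * fourier n t).re) ∧
    ∑ n ∈ Finset.Icc (-(D : ℤ)) (D : ℤ), ψ ‖α n‖₊ < ψ 1 + 1

theorem IsGoodTrig.mem_trigSpan {ψ : ℝ≥0 → ℝ≥0} {D : ℕ} {f : C(UnitAddCircle, ℝ)}
    (h : IsGoodTrig ψ D f) : toComplexMap f ∈ trigSpan D := by
  obtain ⟨α, -, -, hf, -⟩ := h
  have : toComplexMap f = ∑ n ∈ Finset.Icc (-(D : ℤ)) (D : ℤ), (α n : ℂ) • fourier n := by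
    ext t; rw [toComplexMap_apply, hf]; simp
  rw [this]
  refine Submodule.sum_mem _ fun n hn => Submodule.smul_mem _ _ (fourier_mem_trigSpan ?_)
  rw [Finset.mem_Icc] at hn
  omega

theorem sum_Icc_eq_of_zero {M : Type*} [AddCommMonoid M] {f : ℤ → M} {m n : ℕ} (h : m ≤ n)
    (hf : ∀ i : ℤ, m < i.natAbs → f i = 0) :
    ∑ i ∈ Finset.Icc (-(n : ℤ)) (n : ℤ), f i = ∑ i ∈ Finset.Icc (-(m : ℤ)) (m : ℤ), f i := by
  refine (Finset.sum_subset (Finset.Icc_subset_Icc (by omega) (by omega)) fun i _ hi =>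
    hf i ?_).symm
  simp only [Finset.mem_Icc] at hi
  omega

theorem isGoodTrig_one (ψ : ℝ≥0 → ℝ≥0) : IsGoodTrig ψ 0 1 := by
  refine ⟨fun n => if n = 0 then 1 else 0, fun n => by simp, fun n hn => if_neg (by omega),
    fun t => by simp, ⟨1, one_pos, fun N t => ?_⟩, by simp⟩
  rw [sum_Icc_eq_of_zero (m := 0) (Nat.zero_le N) fun n hn => by
    beta_reduce; rw [if_neg (by omega)]; simp]
  simp

theorem IsGoodTrig.exists_mul {ψ : ℝ≥0 → ℝ≥0} (hmono : Monotone ψ) (hψ0 : ψ 0 = 0)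
    (hlim : Tendsto (fun x : ℝ≥0 => ψ x / x ^ 2) (𝓝[>] 0) (𝓝 0)) {D : ℕ}
    {f : C(UnitAddCircle, ℝ)} (h : IsGoodTrig ψ D f) :
    ∃ k A, k ≤ A ∧ 3 * D + 2 * 2 ^ k < 2 ^ A ∧
      IsGoodTrig ψ (D + 2 ^ (A + 2)) (f * (1 + circleBlock k A)) := by
  obtain ⟨α, hαe, hα0, hf, ⟨δ, hδ, hpos⟩, hsum⟩ := h
  set a : ℝ≥0 := ∑ n ∈ Finset.Icc (-(D : ℤ)) (D : ℤ), ‖α n‖₊ with ha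
  -- There are at most 4 · 2^k frequencies ±m in the block and 2D + 1 in f; the multiplier also
  -- dominates the 4D of the edge error.
  obtain ⟨k, hk1, hk2⟩ := exists_block_scale ψ hψ0 hlim a (4 * (2 * D + 1))
    (ψ 1 + 1 - ∑ n ∈ Finset.Icc (-(D : ℤ)) (D : ℤ), ψ ‖α n‖₊) (tsub_pos_of_lt hsum)
    (show 0 < δ / 4 by positivity)
  push_cast at hk1
  set A := k + 3 * D + 2 with hA
  have hkA : k ≤ A := by omega
  have hDA : 3 * D + 2 * 2 ^ k < 2 ^ A := by
    have h1 : 3 * D < 2 ^ (3 * D) := Nat.lt_two_pow_self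
    have h2 : 0 < 2 ^ k := by positivity
    have h3 : 2 ^ A = 4 * (2 ^ k * 2 ^ (3 * D)) := by rw [hA]; ring
    nlinarith
  refine ⟨k, A, hkA, hDA, ?_⟩
  obtain ⟨L, hL⟩ : ∃ L : ℕ, 2 ^ (A + 2) = L := ⟨_, rfl⟩
  rw [hL]
  set γ : ℤ → ℝ := fun n => blockCoeff k A n.natAbs with hγ
  set β := truncConv D α γ with hβ
  have hγe : ∀ n, γ (-n) = γ n := fun n => by simp [hγ]
  have hγs : ∀ n, |γ n| ≤ blockScale k := fun n => abs_blockCoeff_le hkA _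
  have hγlow : ∀ n : ℤ, n.natAbs < 2 ^ A → γ n = 0 := fun n hn =>
    blockCoeff_eq_zero fun h => absurd (blockSupport_bounds hkA h).1 (by omega)
  have hγhigh : ∀ n : ℤ, L ≤ n.natAbs → γ n = 0 := fun n hn =>
    blockCoeff_eq_zero fun h => absurd (blockSupport_bounds hkA h).2 (by rw [hL]; omega)
  have hβs : ∀ n, ‖β n‖₊ ≤ a * blockScale k := nnnorm_truncConv_le D α γ hγs
  have hβlow : ∀ n : ℤ, n.natAbs ≤ D → β n = 0 := by
    intro n hn
    refine Finset.sum_eq_zero fun b hb => ?_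
    rw [Finset.mem_Icc] at hb
    rw [hγlow _ (by omega), mul_zero]
  have hβhigh : ∀ n : ℤ, D + L < n.natAbs → β n = 0 := by
    intro n hn
    refine Finset.sum_eq_zero fun b hb => ?_
    rw [Finset.mem_Icc] at hb
    rw [hγhigh _ (by omega), mul_zero]
  have hβT : ∀ n ∉ (((blockSupport k A).image (fun m : ℕ => (m : ℤ))
      ∪ (blockSupport k A).image (fun m : ℕ => -(m : ℤ))) ×ˢ
        Finset.Icc (-(D : ℤ)) (D : ℤ)).image (fun p => p.1 + p.2), β n = 0 := by
    intro n hn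
    refine Finset.sum_eq_zero fun b hb => ?_
    simp only [hγ]
    rw [blockCoeff_eq_zero, mul_zero]
    intro hmem
    refine hn (Finset.mem_image.2 ⟨(n - b, b), Finset.mem_product.2 ⟨?_, hb⟩, by simp⟩)
    rw [Finset.mem_union, Finset.mem_image, Finset.mem_image]
    rcases Int.natAbs_eq (n - b) with h | h
    · exact Or.inl ⟨_, hmem, h.symm⟩
    · exact Or.inr ⟨_, hmem, h.symm⟩
  have hfx : ∀ t, δ ≤ f t := fun t => by
    have := hpos D t
    rwa [← hf, Complex.ofReal_re] at this
  refine ⟨fun n => α n + β n, fun n => ?_, fun n hn => ?_, fun t => ?_,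
    ⟨δ / 4, by positivity, fun N t => ?_⟩, ?_⟩
  · simp only [hαe, hβ, truncConv_neg D hαe hγe]
  · beta_reduce
    rw [hα0 n (by omega), hβhigh n hn, add_zero]
  · simp only [Complex.ofReal_add, add_mul, Finset.sum_add_distrib]
    rw [sum_Icc_eq_of_zero (m := D) (f := fun n => (α n : ℂ) * fourier n t) (by omega) fun n hn => by
      rw [hα0 n hn, Complex.ofReal_zero, zero_mul], ← hf, hβ, sum_truncConv_mul_fourier]
    have h1 : ∀ b ∈ Finset.Icc (-(D : ℤ)) (D : ℤ),
        (α b * fourier b t) * ∑ n ∈ Finset.Icc (-((D + L : ℕ) : ℤ) - b) ((D + L : ℕ) - b),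
          (γ n : ℂ) * fourier n t = (α b * fourier b t) * (circleBlock k A t : ℂ) := by
      intro b hb
      rw [Finset.mem_Icc] at hb
      rw [circleBlock_apply hkA, hL]
      congr 1
      refine (Finset.sum_subset (Finset.Icc_subset_Icc ?_ ?_) fun n _ hn => ?_).symm
      · omega
      · omega
      · rw [hγhigh n, Complex.ofReal_zero, zero_mul]
        rw [Finset.mem_Icc] at hn
        omega
    rw [Finset.sum_congr rfl h1, ← Finset.sum_mul, ← hf]
    simp only [ContinuousMap.mul_apply, ContinuousMap.add_apply, ContinuousMap.one_apply]
    push_cast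
    ring
  · simp only [Complex.ofReal_add, add_mul, Finset.sum_add_distrib, Complex.add_re]
    rcases le_total N D with hN | hN
    · have h1 : ∑ n ∈ Finset.Icc (-(N : ℤ)) (N : ℤ), (β n : ℂ) * fourier n t = 0 :=
        Finset.sum_eq_zero fun n hn => by
          rw [Finset.mem_Icc] at hn
          rw [hβlow n (by omega), Complex.ofReal_zero, zero_mul]
      rw [h1, Complex.zero_re]
      linarith [hpos N t]
    -- The sum is f(1 + r) with |r| ≤ 1/2, up to δ/4, hence at least δ/4.
    · rw [sum_Icc_eq_of_zero (f := fun n => (α n : ℂ) * fourier n t) hN fun n hn => by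
        rw [hα0 n hn, Complex.ofReal_zero, zero_mul], ← hf, hβ, sum_truncConv_mul_fourier]
      obtain ⟨r, hr, hr'⟩ := sum_blockCoeff_fourier hkA N t
      have h1 : ‖∑ b ∈ Finset.Icc (-(D : ℤ)) (D : ℤ), (α b * fourier b t)
          * ∑ n ∈ Finset.Icc (-(N : ℤ) - b) (N - b), (γ n : ℂ) * fourier n t
          - ((f t * r : ℝ) : ℂ)‖ ≤ δ / 4 := by
        rw [Complex.ofReal_mul, hf, ← hr', Finset.sum_mul, ← Finset.sum_sub_distrib]
        refine le_trans ?_ hk1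
        have h2 : (4 * (2 * D + 1) : ℝ) * (a * blockScale k)
            = ∑ b ∈ Finset.Icc (-(D : ℤ)) (D : ℤ),
              ‖α b‖ * (4 * (2 * D + 1) * blockScale k) := by
          rw [← Finset.sum_mul, ha]
          push_cast
          ring
        rw [h2]
        refine norm_sum_le_of_le _ fun b hb => ?_
        rw [← mul_sub, norm_mul, norm_mul, norm_fourier_apply, mul_one, Complex.norm_real]
        refine mul_le_mul_of_nonneg_left ?_ (norm_nonneg _)
        refine (norm_sum_Icc_sub_le (s := blockScale k) (fun n => ?_) hb).trans ?_
        · rw [norm_mul, norm_fourier_apply, mul_one, Complex.norm_real]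
          exact hγs n
        · refine mul_le_mul_of_nonneg_right ?_ (blockScale k).coe_nonneg
          have : (0 : ℝ) ≤ D := Nat.cast_nonneg D
          linarith
      have h3 := abs_le.1 ((Complex.abs_re_le_norm _).trans h1)
      rw [Complex.sub_re, Complex.ofReal_re] at h3
      rw [Complex.ofReal_re]
      have h4 := abs_le.1 hr
      nlinarith [hfx t]
  · calc ∑ n ∈ Finset.Icc (-((D + L : ℕ) : ℤ)) ((D + L : ℕ) : ℤ), ψ ‖α n + β n‖₊
        ≤ ∑ n ∈ Finset.Icc (-((D + L : ℕ) : ℤ)) ((D + L : ℕ) : ℤ), (ψ ‖α n‖₊ + ψ ‖β n‖₊) := by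
          refine Finset.sum_le_sum fun n _ => ?_
          rcases le_or_gt n.natAbs D with hn | hn
          · simp [hβlow n hn]
          · simp [hα0 n hn]
      _ ≤ ∑ n ∈ Finset.Icc (-(D : ℤ)) (D : ℤ), ψ ‖α n‖₊
          + (4 * (2 * D + 1)) * 2 ^ k * ψ (a * blockScale k) := by
          rw [Finset.sum_add_distrib]
          refine add_le_add (sum_Icc_eq_of_zero (by omega)
            fun n hn => by rw [hα0 n hn, nnnorm_zero, hψ0]).le ?_
          refine (sum_psi_le_card_mul hmono hψ0 _ _ β hβT hβs).trans ?_
          refine mul_le_mul_left ?_ _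
          have h1 : ((((blockSupport k A).image (fun m : ℕ => (m : ℤ))
              ∪ (blockSupport k A).image (fun m : ℕ => -(m : ℤ))) ×ˢ
              Finset.Icc (-(D : ℤ)) (D : ℤ)).image (fun p => p.1 + p.2)).card
              ≤ (2 * 2 ^ k + 2 * 2 ^ k) * (2 * D + 1) := by
            refine Finset.card_image_le.trans ?_
            rw [Finset.card_product]
            refine Nat.mul_le_mul ((Finset.card_union_le _ _).trans (add_le_add
              (Finset.card_image_le.trans (card_blockSupport_le k A))
              (Finset.card_image_le.trans (card_blockSupport_le k A)))) ?_
            rw [Int.card_Icc]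
            omega
          have h2 : (2 * 2 ^ k + 2 * 2 ^ k) * (2 * D + 1) = 4 * (2 * D + 1) * 2 ^ k := by ring
          rw [h2] at h1
          exact_mod_cast h1
      _ < ψ 1 + 1 := lt_tsub_iff_left.1 hk2

theorem complexMean_fourier_mul_sum (D : ℕ) (α : ℤ → ℝ) {n : ℤ} (hn : n.natAbs ≤ D)
    {f : C(UnitAddCircle, ℝ)}
    (hf : ∀ t, (f t : ℂ) = ∑ n ∈ Finset.Icc (-(D : ℤ)) (D : ℤ), (α n : ℂ) * fourier n t) :
    complexMean AddCircle.haarAddCircle (fourier (-n) * toComplexMap f) = α n := by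
  have : toComplexMap f = ∑ n ∈ Finset.Icc (-(D : ℤ)) (D : ℤ), (α n : ℂ) • fourier n := by
    ext t; rw [toComplexMap_apply, hf]; simp
  rw [this, Finset.mul_sum, map_sum, Finset.sum_eq_single n]
  · rw [mul_smul_comm, fourier_mul, neg_add_cancel, fourier_zero_eq_one, map_smul, complexMean_one]
    simp
  · intro m _ hm
    rw [mul_smul_comm, fourier_mul, map_smul, complexMean_fourier (by omega), smul_zero]
  · intro h
    refine absurd ?_ h
    rw [Finset.mem_Icc]
    omega

theorem realPartMap_smul_fourier_mem {n : ℤ} {D : ℕ} (hn : n.natAbs ≤ D) (c : ℂ) :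
    toComplexMap (realPartMap (c • fourier n)) ∈ trigSpan D := by
  have : toComplexMap (realPartMap (c • (fourier n : C(UnitAddCircle, ℂ))))
      = (c / 2) • fourier n + (starRingEnd ℂ c / 2) • fourier (-n) := by
    ext t
    simp only [toComplexMap_apply, realPartMap_apply, ContinuousMap.smul_apply,
      ContinuousMap.add_apply, smul_eq_mul, fourier_neg]
    rw [Complex.re_eq_add_conj, map_mul]
    ring
  rw [this]
  exact Submodule.add_mem _ (Submodule.smul_mem _ _ (fourier_mem_trigSpan hn))
    (Submodule.smul_mem _ _ (fourier_mem_trigSpan (by rwa [Int.natAbs_neg])))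

/-- The hypothesis tests real functions only; Re(c e_n) with c = 1 and c = -i recovers the real and
imaginary parts. -/
theorem complexMean_fourier_eq {μ ν : Measure UnitAddCircle} [IsFiniteMeasure μ]
    [IsFiniteMeasure ν] {D : ℕ} {f : C(UnitAddCircle, ℝ)}
    (h : ∀ u, toComplexMap u ∈ trigSpan D → meanForm μ u = meanForm ν (u * f)) {n : ℤ}
    (hn : n.natAbs ≤ D) : complexMean μ (fourier n) = complexMean ν (fourier n * toComplexMap f) := by
  have key : ∀ c : ℂ, (c * complexMean μ (fourier n)).re
      = (c * complexMean ν (fourier n * toComplexMap f)).re := by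
    intro c
    have h1 := h _ (realPartMap_smul_fourier_mem hn c)
    have h2 := meanForm_mul_realPartMap μ 1 (c • fourier n)
    have h3 : toComplexMap (1 : C(UnitAddCircle, ℝ)) = 1 := by ext; simp
    rw [h3, one_mul, one_mul, map_smul, smul_eq_mul] at h2
    rw [← h2, h1, mul_comm, meanForm_mul_realPartMap, mul_smul_comm, map_smul, mul_comm (fourier n),
      smul_eq_mul]
  refine Complex.ext (by simpa using key 1) ?_
  have := key (-Complex.I)
  simpa using this

theorem sum_Icc_even_mul_fourier_im {α : ℤ → ℝ} (hα : ∀ n, α (-n) = α n) (N : ℕ)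
    (t : UnitAddCircle) :
    (∑ n ∈ Finset.Icc (-(N : ℤ)) (N : ℤ), (α n : ℂ) * fourier n t).im = 0 := by
  rw [← Complex.conj_eq_iff_im, map_sum]
  refine Finset.sum_nbij' (fun a => -a) (fun a => -a) ?_ ?_ (fun a _ => neg_neg a)
    (fun a _ => neg_neg a) fun a _ => ?_
  · intro a ha; simp only [Finset.mem_Icc] at ha ⊢; omega
  · intro a ha; simp only [Finset.mem_Icc] at ha ⊢; omega
  · rw [map_mul, Complex.conj_ofReal, hα, fourier_neg]

/-- A singular probability measure on the circle with nonnegative symmetric partial sums and small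
Fourier coefficients. -/
theorem exists_circle_measure {ψ : ℝ≥0 → ℝ≥0} (hmono : Monotone ψ) (hψ0 : ψ 0 = 0)
    (hlim : Tendsto (fun x : ℝ≥0 => ψ x / x ^ 2) (𝓝[>] 0) (𝓝 0)) :
    ∃ μ : Measure UnitAddCircle, IsProbabilityMeasure μ ∧
      μ.MutuallySingular AddCircle.haarAddCircle ∧
      (∀ (N : ℕ) (t : UnitAddCircle), 0 ≤ fourierPartialSum μ N t) ∧
      Summable (fun n : ℤ => ψ ‖measureFourierCoeff μ n‖₊) := by
  obtain ⟨μ, hμ, hsing, hμf⟩ := exists_singular_of_step AddCircle.haarAddCircle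
    (fun D => {u : C(UnitAddCircle, ℝ) | toComplexMap u ∈ trigSpan D})
    (fun _ _ h _ hu => trigSpan_mono h hu)
    (by
      have h3 : toComplexMap (1 : C(UnitAddCircle, ℝ)) = fourier 0 := by ext; simp
      simp only [Set.mem_ofPred_eq, h3]
      exact fourier_mem_trigSpan (by simp))
    (fun m n u v hu hv => by
      have h3 : toComplexMap (u * v) = toComplexMap u * toComplexMap v := by ext; simp
      simp only [Set.mem_ofPred_eq, h3] at *
      exact trigSpan_mul hu hv) (c := 1 / 256) (by norm_num) (by norm_num)
    (IsGoodTrig ψ) (fun D f h => h.mem_trigSpan) (isGoodTrig_one ψ) (fun D f h => by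
      obtain ⟨k, A, hk, hD, hg⟩ := h.exists_mul hmono hψ0 hlim
      have hpos : 0 < 2 ^ (A + 2) := by positivity
      exact ⟨D + 2 ^ (A + 2), by omega, circleBlock k A,
        trigSpan_mono (by omega) (circleBlock_mem hk), abs_circleBlock_le hk, fun u hu =>
        ⟨meanForm_mul_circleBlock hk (by omega) hu, meanForm_mul_circleBlock_sq hk hD hu⟩, hg⟩)
  have key : ∀ K, ∃ D ≥ K, ∃ α : ℤ → ℝ, (∀ n, α (-n) = α n) ∧
      (∀ n : ℤ, n.natAbs ≤ D → measureFourierCoeff μ n = α n) ∧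
      (∃ δ > 0, ∀ (N : ℕ) (t : UnitAddCircle),
        δ ≤ (∑ n ∈ Finset.Icc (-(N : ℤ)) (N : ℤ), (α n : ℂ) * fourier n t).re) ∧
      ∑ n ∈ Finset.Icc (-(D : ℤ)) (D : ℤ), ψ ‖α n‖₊ < ψ 1 + 1 := by
    intro K
    obtain ⟨D, hD, f, ⟨α, he, -, h1, h2⟩, hf⟩ := hμf K
    refine ⟨D, hD, α, he, fun n hn => ?_, h2⟩
    rw [← complexMean_fourier_mul_sum D α hn h1]
    exact complexMean_fourier_eq hf (n := -n) (by rwa [Int.natAbs_neg])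
  refine ⟨μ, hμ, hsing, fun N t => ?_, ?_⟩
  · obtain ⟨D, hD, α, he, hα, ⟨δ, hδ, h⟩, -⟩ := key N
    have e : fourierPartialSum μ N t
        = ∑ n ∈ Finset.Icc (-(N : ℤ)) (N : ℤ), (α n : ℂ) * fourier n t :=
      Finset.sum_congr rfl fun n hn => by
        rw [Finset.mem_Icc] at hn
        rw [hα n (by omega)]
    -- Nonnegativity in ℂ includes a vanishing imaginary part, which comes from the evenness of α.
    rw [e, Complex.le_def]
    exact ⟨hδ.le.trans (h N t), (sum_Icc_even_mul_fourier_im he N t).symm⟩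
  · rw [← NNReal.summable_coe]
    refine summable_of_sum_le (c := ((ψ 1 + 1 : ℝ≥0) : ℝ)) (fun n => NNReal.coe_nonneg _)
      fun S => ?_
    -- The sum dominates every |n|, so S ⊆ [-D, D].
    obtain ⟨D, hD, α, -, hα, -, h⟩ := key (∑ n ∈ S, n.natAbs)
    rw [← NNReal.coe_sum, NNReal.coe_le_coe]
    refine le_trans ?_ h.le
    refine le_trans (Finset.sum_le_sum_of_subset (t := Finset.Icc (-(D : ℤ)) (D : ℤ))
      fun n hn => ?_) (le_of_eq (Finset.sum_congr rfl fun n hn => ?_))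
    · have := Finset.single_le_sum (f := Int.natAbs) (fun _ _ => Nat.zero_le _) hn
      rw [Finset.mem_Icc]
      omega
    · rw [Finset.mem_Icc] at hn
      rw [hα n (by omega), Complex.nnnorm_real]

/-! ### Binary expansion: from the Cantor group to the unit interval -/

/-- The binary digits attached to a point of the Cantor group: the digit `1` stands for the
sign `-1`. -/
def signDigits (x : CantorGroup) (j : ℕ) : Fin 2 := if x j = -1 then 1 else 0

/-- The point of the unit interval whose binary digits are given by a point of the Cantor group. -/
noncomputable def cantorToUnit (x : CantorGroup) : unitInterval :=
  ⟨Real.ofDigits (signDigits x), Real.ofDigits_nonneg _, Real.ofDigits_le_one _⟩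

theorem continuous_cantorToUnit : Continuous cantorToUnit := by
  refine Continuous.subtype_mk (Real.continuous_ofDigits.comp ?_) _
  refine continuous_pi fun j => ?_
  exact (continuous_of_discreteTopology (f := fun u : ℤˣ => if u = -1 then (1 : Fin 2) else 0)).comp
    (continuous_apply j)

theorem ofDigits_two_eq (a : ℕ → Fin 2) :
    Real.ofDigits a = ((a 0 : ℕ) + Real.ofDigits fun i => a (i + 1)) / 2 := by
  rw [Real.ofDigits_eq_sum_add_ofDigits a 1]
  simp [Real.ofDigitsTerm]
  ring

theorem ofDigits_two_lt_one {a : ℕ → Fin 2} {n : ℕ} (h : a n = 0) : Real.ofDigits a < 1 := by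
  induction n generalizing a with
  | zero =>
    rw [ofDigits_two_eq, h]
    have := Real.ofDigits_le_one fun i => a (i + 1)
    simp only [Fin.val_zero, Nat.cast_zero]
    linarith
  | succ n ih =>
    rw [ofDigits_two_eq]
    have h1 := ih (a := fun i => a (i + 1)) h
    have h2 : ((a 0 : ℕ) : ℝ) ≤ 1 := by exact_mod_cast Nat.lt_succ_iff.1 (a 0).2
    linarith

theorem exists_two_pow_mul_ofDigits (a : ℕ → Fin 2) (j : ℕ) : ∃ m : ℕ,
    (2 : ℝ) ^ (j + 1) * Real.ofDigits a
      = ((2 * m + (a j : ℕ) : ℕ) : ℝ) + Real.ofDigits fun i => a (i + (j + 1)) := by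
  induction j with
  | zero => exact ⟨0, by rw [ofDigits_two_eq]; push_cast; ring_nf⟩
  | succ j ih =>
    obtain ⟨m, hm⟩ := ih
    refine ⟨2 * m + (a j : ℕ), ?_⟩
    have h1 := ofDigits_two_eq fun i => a (i + (j + 1))
    have h2 : (fun i => a (i + 1 + (j + 1))) = fun i => a (i + (j + 1 + 1)) := by
      funext i; congr 1; ring
    simp only [zero_add, h2] at h1
    rw [pow_succ, mul_comm _ (2 : ℝ), mul_assoc, hm, h1]
    push_cast
    ring

/-- A later digit 0 keeps the tail below 1, so the floor is exactly 2m plus the digit, and its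
parity gives the sign. Sequences ending in -1 are excluded because they encode dyadic points a
second time, or the point 1. -/
theorem rademacherPoint_cantorToUnit {x : CantorGroup} (hx : ∀ n, ∃ i ≥ n, x i = 1) :
    rademacherPoint (cantorToUnit x) = x := by
  funext j
  obtain ⟨m, hm⟩ := exists_two_pow_mul_ofDigits (signDigits x) j
  obtain ⟨i, hi, hxi⟩ := hx (j + 1)
  have h1 : Real.ofDigits (fun i => signDigits x (i + (j + 1))) < 1 := by
    refine ofDigits_two_lt_one (n := i - (j + 1)) ?_
    rw [Nat.sub_add_cancel hi, signDigits, hxi]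
    simp
  have h2 : ⌊(2 : ℝ) ^ (j + 1) * (cantorToUnit x : ℝ)⌋₊ = 2 * m + (signDigits x j : ℕ) := by
    rw [Nat.floor_eq_iff (mul_nonneg (by positivity) (cantorToUnit x).2.1)]
    have h3 := Real.ofDigits_nonneg fun i => signDigits x (i + (j + 1))
    change _ ≤ (2 : ℝ) ^ (j + 1) * Real.ofDigits (signDigits x) ∧
      (2 : ℝ) ^ (j + 1) * Real.ofDigits (signDigits x) < _
    rw [hm]
    constructor <;> linarith
  rw [rademacherPoint, h2, pow_add, pow_mul, Int.units_sq, one_pow, one_mul, signDigits]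
  rcases Int.units_eq_one_or (x j) with h | h <;> simp [h]

theorem countable_eventually_neg_one :
    {x : CantorGroup | ¬ ∀ n, ∃ i ≥ n, x i = 1}.Countable := by
  have h : {x : CantorGroup | ¬ ∀ n, ∃ i ≥ n, x i = 1} ⊆ ⋃ n : ℕ, Set.range
      fun (s : Fin n → ℤˣ) (i : ℕ) => if hi : i < n then s ⟨i, hi⟩ else -1 := by
    intro x hx
    simp only [Set.mem_ofPred_eq, not_forall, not_exists, not_and] at hx
    obtain ⟨n, hn⟩ := hx
    refine Set.mem_iUnion.2 ⟨n, fun i => x i, ?_⟩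
    funext i
    by_cases hi : i < n
    · simp [hi]
    · beta_reduce
      rw [dif_neg hi]
      exact ((Int.units_eq_one_or (x i)).resolve_left (hn i (not_lt.1 hi))).symm
  exact (Set.countable_iUnion fun n => Set.countable_range _).mono h

theorem measurable_rademacherPoint : Measurable rademacherPoint := by
  refine measurable_pi_iff.2 fun j => ?_
  have h : Measurable fun x : unitInterval => ⌊(2 : ℝ) ^ (j + 1) * (x : ℝ)⌋₊ :=
    Nat.measurable_floor.comp (measurable_subtype_coe.const_mul _)
  exact (Measurable.of_discrete (f := fun n : ℕ => ((-1) ^ n : ℤˣ))).comp h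

theorem rademacherPoint_eq_of_floor_eq {x y : unitInterval} {k : ℕ}
    (h : ⌊(2 : ℝ) ^ k * (x : ℝ)⌋₊ = ⌊(2 : ℝ) ^ k * (y : ℝ)⌋₊) {i : ℕ} (hi : i < k) :
    rademacherPoint x i = rademacherPoint y i := by
  have key : ∀ z : unitInterval, ⌊(2 : ℝ) ^ (i + 1) * (z : ℝ)⌋₊
      = ⌊(2 : ℝ) ^ k * (z : ℝ)⌋₊ / 2 ^ (k - (i + 1)) := by
    intro z
    rw [← Nat.floor_div_natCast]
    congr 1
    obtain ⟨m, rfl⟩ := Nat.exists_eq_add_of_lt hi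
    have : i + m + 1 - (i + 1) = m := by omega
    rw [this]
    push_cast
    field_simp
    ring
  rw [rademacherPoint, rademacherPoint, key, key, h]

theorem volume_floor_ge {M k : ℕ} (hM : M < 2 ^ k) :
    (2⁻¹ : ℝ≥0∞) ^ k ≤ volume {x : unitInterval | ⌊(2 : ℝ) ^ k * (x : ℝ)⌋₊ = M} := by
  rw [unitInterval.volume_apply]
  have h2 : (0 : ℝ) < 2 ^ k := by positivity
  have hM' : (M : ℝ) + 1 ≤ 2 ^ k := by exact_mod_cast hM
  have h : Set.Ico ((M : ℝ) / 2 ^ k) ((M + 1) / 2 ^ k)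
      ⊆ Subtype.val '' {x : unitInterval | ⌊(2 : ℝ) ^ k * (x : ℝ)⌋₊ = M} := by
    rintro x ⟨hx1, hx2⟩
    have h0 : 0 ≤ x := le_trans (by positivity) hx1
    rw [div_le_iff₀ h2] at hx1
    rw [lt_div_iff₀ h2] at hx2
    refine ⟨⟨x, h0, ?_⟩, ?_, rfl⟩
    · nlinarith
    · simp only [Set.mem_ofPred_eq]
      rw [Nat.floor_eq_iff (by positivity)]
      constructor <;> linarith
  refine le_trans ?_ (measure_mono h)
  rw [Real.volume_Ico, ← sub_div, add_sub_cancel_left, one_div, ENNReal.ofReal_inv_of_pos h2,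
    ENNReal.ofReal_pow (by norm_num), ENNReal.inv_pow]
  simp

theorem map_rademacherPoint_volume : (volume : Measure unitInterval).map rademacherPoint
    = cantorHaar := by
  rw [cantorHaar]
  refine IsProjectiveLimit.unique (P := fun I : Finset ℕ => Measure.pi fun _ : I => signMeasure)
    ?_ (Measure.isProjectiveLimit_infinitePi fun _ : ℕ => signMeasure)
  have : IsProbabilityMeasure ((volume : Measure unitInterval).map rademacherPoint) :=
    Measure.isProbabilityMeasure_map measurable_rademacherPoint.aemeasurable
  refine (isProjectiveLimit_nat_iff (isProjectiveMeasureFamily_pi fun _ : ℕ => signMeasure) _).2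
    fun n => ?_
  have hmeas : Measurable (Preorder.frestrictLe (π := fun _ : ℕ => ℤˣ) n) :=
    Preorder.measurable_frestrictLe n
  have : IsProbabilityMeasure (((volume : Measure unitInterval).map rademacherPoint).map
      (Preorder.frestrictLe n)) := Measure.isProbabilityMeasure_map hmeas.aemeasurable
  -- Between probability measures an inequality is an equality, so a lower bound for the measure of
  -- each cylinder suffices.
  refine (Measure.eq_of_le_of_isProbabilityMeasure ?_).symm
  rw [Measure.le_iff']
  intro s
  have hcard : ∀ p : (i : Finset.Iic n) → ℤˣ, Measure.pi (fun _ : Finset.Iic n => signMeasure) {p}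
      ≤ ((volume : Measure unitInterval).map rademacherPoint).map (Preorder.frestrictLe n) {p} := by
    intro p
    rw [Measure.pi_singleton, Measure.map_apply hmeas (measurableSet_singleton _),
      Measure.map_apply measurable_rademacherPoint (hmeas (measurableSet_singleton _))]
    have hs : ∀ u : ℤˣ, signMeasure {u} = 2⁻¹ := by
      intro u
      rcases Int.units_eq_one_or u with rfl | rfl <;> simp [signMeasure]
    simp only [hs, Finset.prod_const, Finset.card_univ, Fintype.card_coe, Nat.card_Iic]
    -- Completing p by signs 1, that is digits 0, gives the left endpoint of the dyadic interval
    -- with digits p.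
    let y : CantorGroup := fun i => if hi : i ≤ n then p ⟨i, Finset.mem_Iic.2 hi⟩ else 1
    have hy : ∀ m, ∃ i ≥ m, y i = 1 := fun m =>
      ⟨m + n + 1, by omega, dif_neg (by omega)⟩
    have hlt : (cantorToUnit y : ℝ) < 1 :=
      ofDigits_two_lt_one (n := n + 1) (by simp [signDigits, y])
    have hM : ⌊(2 : ℝ) ^ (n + 1) * (cantorToUnit y : ℝ)⌋₊ < 2 ^ (n + 1) := by
      rw [Nat.floor_lt (mul_nonneg (by positivity) (cantorToUnit y).2.1)]
      push_cast
      exact mul_lt_of_lt_one_right (by positivity) hlt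
    refine (volume_floor_ge hM).trans (measure_mono fun x hx => ?_)
    simp only [Set.mem_preimage, Set.mem_singleton_iff]
    funext i
    have hi : (i : ℕ) ≤ n := Finset.mem_Iic.1 i.2
    have h1 := rademacherPoint_eq_of_floor_eq (i := i) hx (by omega)
    rw [rademacherPoint_cantorToUnit hy] at h1
    exact h1.trans (dif_pos hi)
  have hfin : s.Finite := s.toFinite
  rw [← hfin.coe_toFinset, ← sum_measure_singleton, ← sum_measure_singleton]
  exact Finset.sum_le_sum fun p _ => hcard p

/-! ### Absence of atoms and transfer -/

/-- The kernel of order 2^D is the product of the factors 1 + x_j y_j, j < D. -/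
theorem walsh_dirichlet_nonneg (D : ℕ) (x y : CantorGroup) :
    0 ≤ ∑ n ∈ Finset.range (2 ^ D), walsh n x * walsh n y := by
  induction D with
  | zero => simp [walsh_zero]
  | succ D ih =>
    have h : ∑ n ∈ Finset.range (2 ^ (D + 1)), walsh n x * walsh n y
        = (∑ n ∈ Finset.range (2 ^ D), walsh n x * walsh n y)
          * (1 + walsh (2 ^ D) x * walsh (2 ^ D) y) := by
      rw [pow_succ, mul_two, Finset.sum_range_add, mul_add, mul_one, Finset.sum_mul]
      congr 1
      refine Finset.sum_congr rfl fun n hn => ?_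
      rw [add_comm, add_two_pow_eq_xor (Finset.mem_range.1 hn), walsh_xor, walsh_xor]
      ring
    rw [h]
    refine mul_nonneg ih ?_
    have h1 : |walsh (2 ^ D) x * walsh (2 ^ D) y| = 1 := by
      rw [abs_mul, abs_walsh, abs_walsh, one_mul]
    linarith [(abs_le.1 h1.le).1]

/-- Markov's inequality for the nonnegative Dirichlet kernel, whose value on the diagonal is 2^D. -/
theorem measureReal_singleton_le (μ : Measure CantorGroup) [IsFiniteMeasure μ] (x : CantorGroup)
    (D : ℕ) : 2 ^ D * μ.real {x}
      ≤ ∑ n ∈ Finset.range (2 ^ D), walshCoeff μ n * walsh n x := by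
  let K : C(CantorGroup, ℝ) := ∑ n ∈ Finset.range (2 ^ D), walsh n x • walshMap n
  have hK : ∀ y, K y = ∑ n ∈ Finset.range (2 ^ D), walsh n x * walsh n y := fun y => by simp [K]
  have h1 : meanForm μ K = ∑ n ∈ Finset.range (2 ^ D), walshCoeff μ n * walsh n x := by
    simp only [K, map_sum, map_smul, smul_eq_mul]
    exact Finset.sum_congr rfl fun n _ => mul_comm _ _
  rw [← h1]
  have hKx : K x = 2 ^ D := by rw [hK]; simp [walsh_mul_self]
  have h2 := mul_meas_ge_le_integral_of_nonneg (μ := μ) (f := fun y => K y)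
    (Eventually.of_forall fun y => (walsh_dirichlet_nonneg D x y).trans_eq (hK y).symm)
    (integrable_continuousMap K μ) (2 ^ D)
  refine le_trans (mul_le_mul_of_nonneg_left ?_ (by positivity)) h2
  exact measureReal_mono (by rintro _ rfl; exact hKx.ge)

theorem nullSingletonClass_of_sum_le (μ : Measure CantorGroup) [IsFiniteMeasure μ]
    (h : ∀ K, ∃ D ≥ K, ∀ x,
      ∑ n ∈ Finset.range (2 ^ D), walshCoeff μ n * walsh n x ≤ (3 / 2) ^ D) : NullSingletonClass μ := by
  refine ⟨fun x => ?_⟩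
  rw [← measureReal_eq_zero_iff]
  refine le_antisymm (le_of_forall_pos_le_add fun ε hε => ?_) measureReal_nonneg
  obtain ⟨K, hK⟩ := exists_pow_lt_of_lt_one hε (show (3 / 4 : ℝ) < 1 by norm_num)
  obtain ⟨D, hD, hx⟩ := h K
  have h1 := (measureReal_singleton_le μ x D).trans (hx x)
  have h2 : (3 / 2 : ℝ) ^ D = 2 ^ D * (3 / 4) ^ D := by rw [← mul_pow]; norm_num
  rw [h2] at h1
  have h3 := le_of_mul_le_mul_left h1 (by positivity)
  have h4 : (3 / 4 : ℝ) ^ D ≤ (3 / 4) ^ K := pow_le_pow_of_le_one (by norm_num) (by norm_num) hD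
  linarith

theorem rademacherPoint_cantorToUnit_ae (μ : Measure CantorGroup) [NullSingletonClass μ] :
    ∀ᵐ x ∂μ, rademacherPoint (cantorToUnit x) = x := by
  filter_upwards [countable_eventually_neg_one.ae_notMem μ] with x hx
  simp only [not_not] at hx
  exact rademacherPoint_cantorToUnit hx

theorem walshUnitCoeff_map (μ : Measure CantorGroup) [NullSingletonClass μ] (n : ℕ) :
    walshUnitCoeff (μ.map cantorToUnit) n = walshCoeff μ n := by
  have hm : Measurable (walshUnit n) := (continuous_walsh n).measurable.comp
    measurable_rademacherPoint
  rw [walshUnitCoeff, integral_map continuous_cantorToUnit.measurable.aemeasurable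
    hm.aestronglyMeasurable]
  refine integral_congr_ae ?_
  filter_upwards [rademacherPoint_cantorToUnit_ae μ] with x hx
  rw [walshUnit, hx]

theorem mutuallySingular_map_cantorToUnit {μ : Measure CantorGroup} [NullSingletonClass μ]
    (h : μ.MutuallySingular cantorHaar) : (μ.map cantorToUnit).MutuallySingular volume := by
  obtain ⟨s, hs, h1, h2⟩ := h
  refine ⟨rademacherPoint ⁻¹' s, measurable_rademacherPoint hs, ?_, ?_⟩
  · rw [Measure.map_apply continuous_cantorToUnit.measurable (measurable_rademacherPoint hs)]
    refine measure_mono_null_ae ?_ h1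
    filter_upwards [rademacherPoint_cantorToUnit_ae μ] with x hx hxs
    have h3 : rademacherPoint (cantorToUnit x) ∈ s := hxs
    rwa [hx] at h3
  · rw [← Set.preimage_compl, ← Measure.map_apply measurable_rademacherPoint hs.compl,
      map_rademacherPoint_volume, h2]

theorem mainTheorem2 (ψ : ℝ≥0 → ℝ≥0) (hmono : Monotone ψ) (hsurj : Function.Surjective ψ)
    (hlim : Tendsto (fun x : ℝ≥0 => ψ x / x ^ 2) (𝓝[>] 0) (𝓝 0)) :
    (∃ μ : Measure CantorGroup, IsProbabilityMeasure μ ∧ μ.MutuallySingular cantorHaar ∧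
      (∀ (N : ℕ) (x : CantorGroup), 0 ≤ walshPartialSum μ N x) ∧
      Summable (fun n : ℕ => ψ ‖walshCoeff μ n‖₊)) ∧
    (∃ μ : Measure unitInterval, IsProbabilityMeasure μ ∧ μ.MutuallySingular volume ∧
      (∀ (N : ℕ) (x : unitInterval), 0 ≤ walshUnitPartialSum μ N x) ∧
      Summable (fun n : ℕ => ψ ‖walshUnitCoeff μ n‖₊)) ∧
    (∃ μ : Measure UnitAddCircle, IsProbabilityMeasure μ ∧
      μ.MutuallySingular AddCircle.haarAddCircle ∧
      (∀ (N : ℕ) (t : UnitAddCircle), 0 ≤ fourierPartialSum μ N t) ∧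
      Summable (fun n : ℤ => ψ ‖measureFourierCoeff μ n‖₊)) := by
  have hψ0 : ψ 0 = 0 := by
    obtain ⟨x, hx⟩ := hsurj 0
    have h : ψ 0 ≤ ψ x := hmono zero_le
    exact le_antisymm (h.trans hx.le) zero_le
  obtain ⟨μ, hμ, hsing, hpos, hsum, hbd⟩ := exists_walsh_measure hmono hψ0 hlim
  have := nullSingletonClass_of_sum_le μ hbd
  refine ⟨⟨μ, hμ, hsing, hpos, hsum⟩, ⟨μ.map cantorToUnit,
    Measure.isProbabilityMeasure_map continuous_cantorToUnit.measurable.aemeasurable,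
    mutuallySingular_map_cantorToUnit hsing, fun N x => ?_, ?_⟩,
    exists_circle_measure hmono hψ0 hlim⟩
  -- The coefficients agree and the sum is evaluated at `rademacherPoint x`, so positivity holds at
  -- every x, dyadic points included.
  · simp only [walshUnitPartialSum, walshUnitCoeff_map]
    exact hpos N (rademacherPoint x)
  · simpa only [walshUnitCoeff_map] using hsum
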